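/- Let $d\in\mathbb N_0$, let $\mathscr D=C_c^\infty(\mathbb R^d;\mathbb C)$ and $\mathscr D'$ its space of distributions, $\langle f,g\rangle=\int\bar f g$ on $\mathscr D$, and $\langle f,T\rangle=T(\bar f)$ for $f\in\mathscr D$, $T\in\mathscr D'$. Let $\varpi:\mathbb R^d\to\mathbb R$ be a smooth function with $\varpi\ge\mu$ for some constant $\mu>0$; smooth functions of $\varpi$ act on $\mathscr D$ by multiplication and on $\mathscr D'$ by transposition. Let $v\in\mathscr D'$. Let $\mathbb W$ be the C*-algebra of canonical commutation relations generated by nonzero elements $W(f)$, $f\in\mathscr D$, with $$W(f)^*=W(-f),\qquad W(f)W(g)=e^{-i\pi^2\operatorname{Im}\langle f,g\rangle}W(f+g).$$ There are a unique one-parameter group $(\tau_t)_{t\in\mathbb R}$ of (isometric) *-automorphisms of $\mathbb W$ with $$\tau_t(W(f))=e^{2\pi i\operatorname{Re}\langle f,(e^{-it\varpi}-1)v/\varpi\rangle}\,W(e^{it\varpi}f)\qquad(f\in\mathscr D)$$ (the van Hove--Miyatake dynamics with source $v$) and a unique normalized regular state $\omega_\infty$ on $\mathbb W$ with $$\omega_\infty(W(f))=e^{-\frac{\pi^2}{2}\langle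 f,f\rangle}\,e^{2\pi i\operatorname{Re}\langle f,-v/\varpi\rangle}\qquad(f\in\mathscr D).$$ Up to unitary equivalence, the GNS representation $(\mathscr H_{\omega_\infty},\pi_{\omega_\infty},\Omega_{\omega_\infty})$ of $\omega_\infty$ satisfies the following. 1. $\mathscr H_{\omega_\infty}=\bigoplus_{n\ge0}L^2((\mathbb R^d)^n)_{\mathrm s}$ is the symmetric Fock space over $L^2(\mathbb R^d)$, where $L^2((\mathbb R^d)^0)_{\mathrm s}=\mathbb C$ and, for $n>0$, $L^2((\mathbb R^d)^n)_{\mathrm s}$ is the space of square integrable functions that are symmetric under permutations of their $n$ variables in $\mathbb R^d$. 2. $\Omega_{\omega_\infty}=(1,0,0,\dots)$; this vector is cyclic, and $\omega_\infty(a)=\langle\Omega_{\omega_\infty},\pi_{\omega_\infty}(a)\Omega_{\omega_\infty}\rangle$ for all $a\in\mathbb W$. 3. For all $a\in\mathbb W$ and $t\in\mathbb R$, $$\pi_{\omega_\infty}(\tau_t(a))=e^{it\,\mathrm d\Gamma(\varpi)}\,\pi_{\omega_\infty}(a)\,e^{-it\,\mathrm d\Gamma(\varpi)},$$ where $\mathrm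 d\Gamma(\varpi)$, the second quantization of $\varpi$, is the operator with maximal domain that multiplies the $n$-particle component by $\varpi(k_1)+\dots+\varpi(k_n)$, and $e^{it\,\mathrm d\Gamma(\varpi)}$ is the strongly continuous unitary group that it generates. -/

import Mathlib

open MeasureTheory TopologicalSpace Complex
open scoped Distributions ContDiff ComplexOrder InnerProductSpace lp

noncomputable section

namespace VanHove

/-! ### Test functions, distributions and multiplication by smooth functions -/

/-- Momentum space `ℝ^d`. -/
abbrev Mom (d : ℕ) : Type := EuclideanSpace ℝ (Fin d)

/-- Complex-valued smooth compactly supported functions on `ℝ^d`. -/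
abbrev Test (d : ℕ) : Type := 𝓓((⊤ : Opens (Mom d)), ℂ)

/-- Complex distributions on `ℝ^d`. -/
abbrev Dist (d : ℕ) : Type := 𝓓'((⊤ : Opens (Mom d)), ℂ)

variable {d : ℕ}

/-- Multiplication of test functions by a smooth function `m`. -/
def mulTest (m : Mom d → ℂ) (hm : ContDiff ℝ ∞ m) : Test d →ₗ[ℂ] Test d where
  toFun f :=
    { toFun := fun k => m k * f k
      contDiff' := hm.mul f.contDiff
      hasCompactSupport' := f.hasCompactSupport.mul_left
      tsupport_subset' := Set.subset_univ _ }
  map_add' f g := by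
    ext k
    change m k * (f k + g k) = m k * f k + m k * g k
    ring
  map_smul' c f := by
    ext k
    change m k * (c * f k) = c * (m k * f k)
    ring

@[simp] lemma mulTest_apply (m : Mom d → ℂ) (hm : ContDiff ℝ ∞ m) (f : Test d) (k : Mom d) :
    mulTest m hm f k = m k * f k := rfl

/-- Complex conjugation of test functions. -/
def conjTest (f : Test d) : Test d :=
  TestFunction.postcompCLM (𝕜 := ℝ) (conjCLE : ℂ →L[ℝ] ℂ) f

@[simp] lemma conjTest_apply (f : Test d) (k : Mom d) :
    conjTest f k = (starRingEnd ℂ) (f k) := rfl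

/-- The `ℂ`-linear functional on complex test functions given by a distribution:
`T(f) = T(Re f) + i T(Im f)`. -/
def distFunctional (T : Dist d) : Test d →ₗ[ℂ] ℂ where
  toFun f := T (TestFunction.postcompCLM (𝕜 := ℝ) reCLM f) +
    I * T (TestFunction.postcompCLM (𝕜 := ℝ) imCLM f)
  map_add' f g := by
    simp only [map_add]
    ring
  map_smul' c f := by
    have h1 : TestFunction.postcompCLM (𝕜 := ℝ) reCLM (c • f) =
        c.re • TestFunction.postcompCLM (𝕜 := ℝ) reCLM f -
          c.im • TestFunction.postcompCLM (𝕜 := ℝ) imCLM f := by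
      ext k
      change (c * f k).re = c.re * (f k).re - c.im * (f k).im
      simp
    have h2 : TestFunction.postcompCLM (𝕜 := ℝ) imCLM (c • f) =
        c.re • TestFunction.postcompCLM (𝕜 := ℝ) imCLM f +
          c.im • TestFunction.postcompCLM (𝕜 := ℝ) reCLM f := by
      ext k
      change (c * f k).im = c.re * (f k).im + c.im * (f k).re
      simp
    rw [h1, h2]
    simp only [map_sub, map_add, map_smul, real_smul, RingHom.id_apply, smul_eq_mul]
    linear_combination (exp := 1)
      (T (TestFunction.postcompCLM (𝕜 := ℝ) reCLM f) +
        I * T (TestFunction.postcompCLM (𝕜 := ℝ) imCLM f)) * (re_add_im c) +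
      (-(c.im : ℂ) * T (TestFunction.postcompCLM (𝕜 := ℝ) imCLM f)) * I_mul_I

/-- Multiplication of a functional on test functions by a smooth function `m`, defined by
transposition: `(m T)(f) = T(m f)`. -/
def smoothMul (m : Mom d → ℂ) (hm : ContDiff ℝ ∞ m) (T : Test d →ₗ[ℂ] ℂ) : Test d →ₗ[ℂ] ℂ :=
  T ∘ₗ mulTest m hm

/-- The sesquilinear duality bracket `⟨f, T⟩ = T(f̄)`. -/
def bracket (f : Test d) (T : Test d →ₗ[ℂ] ℂ) : ℂ := T (conjTest f)

/-- The `L²` inner product of test functions, antilinear in the first argument. -/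
def testInner (f g : Test d) : ℂ := ∫ k, (starRingEnd ℂ) (f k) * g k

/-! ### The dispersion relation -/

/-- A massive dispersion relation `ϖ ≥ μ > 0` acting by multiplication on test functions. -/
structure Dispersion (d : ℕ) where
  toFun : Mom d → ℝ
  smooth : ContDiff ℝ ∞ toFun
  mass : ℝ
  mass_pos : 0 < mass
  mass_le : ∀ k, mass ≤ toFun k

namespace Dispersion

variable (ϖ : Dispersion d)

/-- The function `e^{itϖ}`. -/
def phase (t : ℝ) (k : Mom d) : ℂ := exp (I * (t * ϖ.toFun k : ℝ))

/-- The function `1/ϖ`. -/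
def recip (k : Mom d) : ℂ := ((ϖ.toFun k)⁻¹ : ℝ)

lemma phase_smooth (t : ℝ) : ContDiff ℝ ∞ (ϖ.phase t) := by
  have h := ϖ.smooth
  unfold phase
  exact (contDiff_const.mul (ofRealCLM.contDiff.comp (contDiff_const.mul h))).cexp

lemma recip_smooth : ContDiff ℝ ∞ ϖ.recip :=
  ofRealCLM.contDiff.comp
    (ϖ.smooth.inv fun k => (lt_of_lt_of_le ϖ.mass_pos (ϖ.mass_le k)).ne')

/-- The operator `e^{itϖ}` on test functions. -/
def evolve (t : ℝ) : Test d →ₗ[ℂ] Test d := mulTest (ϖ.phase t) (ϖ.phase_smooth t)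

/-- `v/ϖ`. -/
def divSource (v : Dist d) : Test d →ₗ[ℂ] ℂ :=
  smoothMul ϖ.recip ϖ.recip_smooth (distFunctional v)

/-- `(e^{-itϖ} - 1) v/ϖ`. -/
def driftSource (v : Dist d) (t : ℝ) : Test d →ₗ[ℂ] ℂ :=
  smoothMul (fun k => ϖ.phase (-t) k - 1) ((ϖ.phase_smooth (-t)).sub contDiff_const)
    (ϖ.divSource v)

end Dispersion

/-! ### The C*-algebra of canonical commutation relations

The C*-algebra generated by nonzero elements `W(f)` with `W(f)* = W(-f)` and
`W(f) W(g) = e^{-iπ² Im⟨f,g⟩} W(f+g)` is unique up to isomorphism because the symplectic form is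
nondegenerate. It is constructed in the usual way, as the norm closure of the *-algebra generated
by the operators `W(f) δ_h = e^{-iπ² Im⟨f,h⟩} δ_{f+h}` on `ℓ²(𝓓)`, where `𝓓` is seen as a discrete
set. -/

lemma testInner_integrable (f g : Test d) :
    Integrable fun k => (starRingEnd ℂ) (f k) * g k := by
  refine Continuous.integrable_of_hasCompactSupport
    ((continuous_conj.comp f.continuous).mul g.continuous) ?_
  exact g.hasCompactSupport.mul_left

lemma testInner_add_left (f g h : Test d) :
    testInner (f + g) h = testInner f h + testInner g h := by
  unfold testInner
  rw [← integral_add (testInner_integrable f h) (testInner_integrable g h)]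
  refine integral_congr_ae (.of_forall fun k => ?_)
  change (starRingEnd ℂ) (f k + g k) * h k = _
  simp only [map_add]
  ring

lemma testInner_add_right (f g h : Test d) :
    testInner f (g + h) = testInner f g + testInner f h := by
  unfold testInner
  rw [← integral_add (testInner_integrable f g) (testInner_integrable f h)]
  refine integral_congr_ae (.of_forall fun k => ?_)
  change (starRingEnd ℂ) (f k) * (g k + h k) = _
  ring

lemma testInner_conj (f g : Test d) : (starRingEnd ℂ) (testInner f g) = testInner g f := by
  unfold testInner
  rw [← integral_conj]
  refine integral_congr_ae (.of_forall fun k => ?_)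
  simp [mul_comm]

/-- The symplectic form `Im⟨f, g⟩`. -/
def symp (f g : Test d) : ℝ := (testInner f g).im

lemma symp_add_left (f g h : Test d) : symp (f + g) h = symp f h + symp g h := by
  simp [symp, testInner_add_left]

lemma symp_add_right (f g h : Test d) : symp f (g + h) = symp f g + symp f h := by
  simp [symp, testInner_add_right]

lemma symp_self (f : Test d) : symp f f = 0 := by
  have h := congrArg Complex.im (testInner_conj f f)
  simp only [conj_im] at h
  unfold symp
  linarith

/-- The phase `e^{-iπ² Im⟨f,g⟩}`. -/
def weylPhase (f g : Test d) : ℂ := exp (-I * (Real.pi ^ 2 * symp f g : ℝ))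

lemma norm_weylPhase (f g : Test d) : ‖weylPhase f g‖ = 1 := by
  have : -I * (Real.pi ^ 2 * symp f g : ℝ) = ((-(Real.pi ^ 2 * symp f g) : ℝ) : ℂ) * I := by
    push_cast
    ring
  rw [weylPhase, this, norm_exp_ofReal_mul_I]

/-- `ℓ²` over the discrete set of test functions. -/
abbrev RegSpace (d : ℕ) : Type := lp (fun _ : Test d => ℂ) 2

lemma weyl_memlp (f : Test d) (ψ : RegSpace d) :
    Memℓp (fun h => weylPhase f h * ψ (h - f)) 2 := by
  have h := (lp.memℓp ψ).summable (by norm_num)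
  refine memℓp_gen ?_
  simp only [norm_mul, norm_weylPhase, one_mul]
  exact (Equiv.subRight f).summable_iff.mpr h

/-- The isometry `(W(f) ψ)(h) = e^{-iπ² Im⟨f,h⟩} ψ(h - f)` of `ℓ²(𝓓)`. -/
def weylIsometry (f : Test d) : RegSpace d →ₗᵢ[ℂ] RegSpace d where
  toFun ψ := ⟨fun h => weylPhase f h * ψ (h - f), weyl_memlp f ψ⟩
  map_add' ψ χ := by
    ext h
    change weylPhase f h * (ψ (h - f) + χ (h - f)) = _ + _
    ring
  map_smul' c ψ := by
    ext h
    change weylPhase f h * (c * ψ (h - f)) = c * (weylPhase f h * ψ (h - f))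
    ring
  norm_map' ψ := by
    rw [lp.norm_eq_tsum_rpow (by norm_num), lp.norm_eq_tsum_rpow (by norm_num)]
    congr 1
    rw [← (Equiv.subRight f).tsum_eq (fun h => ‖ψ h‖ ^ (2 : ENNReal).toReal)]
    refine tsum_congr fun h => ?_
    change ‖weylPhase f h * ψ (h - f)‖ ^ _ = ‖ψ (h - f)‖ ^ _
    rw [norm_mul, norm_weylPhase, one_mul]

/-- The unitary Weyl operators on `ℓ²(𝓓)`. -/
def weylOp (f : Test d) : RegSpace d →L[ℂ] RegSpace d := (weylIsometry f).toContinuousLinearMap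

lemma weylOp_apply (f : Test d) (ψ : RegSpace d) (h : Test d) :
    weylOp f ψ h = weylPhase f h * ψ (h - f) := rfl

lemma weylOp_mul (f g : Test d) : weylOp f * weylOp g = weylPhase f g • weylOp (f + g) := by
  ext ψ h
  change weylPhase f h * (weylPhase g (h - f) * ψ (h - f - g)) =
    weylPhase f g * (weylPhase (f + g) h * ψ (h - (f + g)))
  have e : symp g (h - f) = symp g h + symp f g := by
    have h1 := symp_add_right g (h - f) f
    have h2 := symp_self (f + g)
    rw [symp_add_left, symp_add_right, symp_add_right, symp_self, symp_self] at h2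
    rw [sub_add_cancel] at h1
    linarith
  have e2 : weylPhase f h * weylPhase g (h - f) = weylPhase f g * weylPhase (f + g) h := by
    simp only [weylPhase, ← Complex.exp_add, e, symp_add_left]
    congr 1
    push_cast
    ring
  rw [← mul_assoc, e2, mul_assoc, sub_sub]

/-- The C*-algebra of canonical commutation relations over `(𝓓, Im⟨·,·⟩)`. -/
def WeylAlgebra (d : ℕ) : Type :=
  ↥(StarAlgebra.adjoin ℂ (Set.range (weylOp (d := d)))).topologicalClosure

instance weylClosed (d : ℕ) : IsClosed
    ((StarAlgebra.adjoin ℂ (Set.range (weylOp (d := d)))).topologicalClosure :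
      Set (RegSpace d →L[ℂ] RegSpace d)) :=
  StarSubalgebra.isClosed_topologicalClosure _

instance instCStarWeyl (d : ℕ) : CStarAlgebra (WeylAlgebra d) :=
  inferInstanceAs (CStarAlgebra
    ↥(StarAlgebra.adjoin ℂ (Set.range (weylOp (d := d)))).topologicalClosure)

/-- The usual order of a C*-algebra. -/
instance instOrderWeyl (d : ℕ) : PartialOrder (WeylAlgebra d) := CStarAlgebra.spectralOrder _

instance instStarOrderedWeyl (d : ℕ) : StarOrderedRing (WeylAlgebra d) :=
  CStarAlgebra.spectralOrderedRing _

/-- The Weyl operators `W(f)`. -/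
def weyl (f : Test d) : WeylAlgebra d :=
  ⟨weylOp f, StarSubalgebra.le_topologicalClosure _
    (StarAlgebra.subset_adjoin ℂ _ (Set.mem_range_self f))⟩

lemma weyl_mul (f g : Test d) : weyl f * weyl g = weylPhase f g • weyl (f + g) :=
  Subtype.ext (weylOp_mul f g)

lemma weyl_ne_zero (f : Test d) : weyl f ≠ 0 := by
  classical
  intro h
  have h0 : weylOp f = 0 := congrArg Subtype.val h
  have h1 : ‖weylIsometry f (lp.single 2 (0 : Test d) (1 : ℂ))‖ = 0 := by
    change ‖weylOp f _‖ = 0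
    rw [h0]
    simp
  rw [LinearIsometry.norm_map] at h1
  simp at h1

lemma weylOp_zero : weylOp (0 : Test d) = 1 := by
  have hs : ∀ h : Test d, symp 0 h = 0 := fun h => by
    simpa using symp_add_left 0 0 h
  ext ψ h
  rw [weylOp_apply]
  simp [weylPhase, hs]

lemma weyl_star (f : Test d) : star (weyl f) = weyl (-f) := by
  refine Subtype.ext ?_
  change star (weylOp f) = weylOp (-f)
  have h1 : star (weylOp f) * weylOp f = 1 :=
    (weylIsometry f).adjoint_comp_self
  have h2 : weylOp f * weylOp (-f) = 1 := by
    have hs : symp f (-f) = 0 := by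
      have := symp_add_right f f (-f)
      rw [symp_self, add_neg_cancel] at this
      have h0 : symp f 0 = 0 := by simpa using symp_add_right f 0 0
      linarith
    rw [weylOp_mul, add_neg_cancel, weylOp_zero]
    simp [weylPhase, hs]
  calc star (weylOp f) = star (weylOp f) * (weylOp f * weylOp (-f)) := by rw [h2, mul_one]
    _ = weylOp (-f) := by rw [← mul_assoc, h1, one_mul]

/-! ### The van Hove dynamics and the coherent state -/

/-- `τ` is the van Hove dynamical map: the group of *-automorphisms with
`τ(t)[W(f)] = W(e^{itϖ} f) e^{2πi Re⟨f, (e^{-itϖ}-1) v/ϖ⟩}`. -/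
structure IsVanHoveDynamics (ϖ : Dispersion d) (v : Dist d)
    (τ : ℝ → WeylAlgebra d ≃⋆ₐ[ℂ] WeylAlgebra d) : Prop where
  map_zero : ∀ a, τ 0 a = a
  map_add : ∀ s t a, τ (s + t) a = τ s (τ t a)
  isometry : ∀ t, Isometry (τ t)
  map_weyl : ∀ t f, τ t (weyl f) =
    exp (2 * Real.pi * I * ((bracket f (ϖ.driftSource v t)).re : ℂ)) • weyl (ϖ.evolve t f)

/-- `ρ` is the coherent state centered around `-v/ϖ`: the normalized regular state with
`ρ(W(f)) = e^{-π²⟨f,f⟩/2} e^{2πi Re⟨f, -v/ϖ⟩}`. -/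
structure IsCoherentState (ϖ : Dispersion d) (v : Dist d) (ρ : WeylAlgebra d →ₚ[ℂ] ℂ) :
    Prop where
  map_one : ρ 1 = 1
  continuous : Continuous ρ
  regular : ∀ f, Continuous fun r : ℝ => ρ (weyl ((r : ℂ) • f))
  map_weyl : ∀ f, ρ (weyl f) = exp (-(Real.pi ^ 2 / 2) * testInner f f) *
    exp (2 * Real.pi * I * ((bracket f (-ϖ.divSource v)).re : ℂ))

/-- The canonical vector `Ω_ρ`, the class of `1`, in the GNS space of `ρ`. -/
def gnsVector (ρ : WeylAlgebra d →ₚ[ℂ] ℂ) : ρ.GNS := ((ρ.toPreGNS 1 : ρ.PreGNS) : ρ.GNS)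

/-! ### The symmetric Fock space -/

lemma perm_measurePreserving {n : ℕ} (σ : Equiv.Perm (Fin n)) :
    MeasurePreserving (fun k : Fin n → Mom d => k ∘ σ) volume volume :=
  volume_preserving_arrowCongr' σ.symm (MeasurableEquiv.refl (Mom d)) (MeasurePreserving.id _)

/-- Square integrable functions on `(ℝ^d)^n` which are symmetric under permutations of the `n`
variables in `ℝ^d`. For `n = 0` this is `ℂ`, as `(ℝ^d)^0` is a point of mass one. -/
def symL2 (d n : ℕ) : Submodule ℂ (Lp ℂ 2 (volume : Measure (Fin n → Mom d))) where
  carrier := {ψ | ∀ σ : Equiv.Perm (Fin n),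
    Lp.compMeasurePreserving (fun k => k ∘ σ) (perm_measurePreserving σ) ψ = ψ}
  zero_mem' σ := map_zero _
  add_mem' {ψ χ} hψ hχ σ := by rw [map_add, hψ σ, hχ σ]
  smul_mem' c ψ hψ σ := by
    have := (Lp.compMeasurePreservingₗ ℂ (fun k : Fin n → Mom d => k ∘ σ)
      (perm_measurePreserving σ) (E := ℂ) (p := 2)).map_smul c ψ
    exact this.trans (congrArg (c • ·) (hψ σ))

instance symL2_complete (d n : ℕ) : CompleteSpace (symL2 d n) := by
  suffices h : IsClosed (symL2 d n : Set (Lp ℂ 2 (volume : Measure (Fin n → Mom d)))) from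
    h.completeSpace_coe
  have : (symL2 d n : Set (Lp ℂ 2 (volume : Measure (Fin n → Mom d)))) =
      ⋂ σ : Equiv.Perm (Fin n), {ψ |
        Lp.compMeasurePreserving (fun k => k ∘ σ) (perm_measurePreserving σ) ψ = ψ} := by
    ext ψ
    rw [Set.mem_iInter]
    rfl
  rw [this]
  exact isClosed_iInter fun σ =>
    isClosed_eq (Lp.isometry_compMeasurePreserving (perm_measurePreserving σ)).continuous
      continuous_id

/-- The symmetric Fock space over `L²(ℝ^d)`: the Hilbert direct sum of the spaces `symL2 d n`. -/
abbrev Fock (d : ℕ) : Type := lp (fun n : ℕ => symL2 d n) 2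

/-- The element `1 ∈ ℂ = L²((ℝ^d)^0)`. -/
def oneL2 (d : ℕ) : symL2 d 0 :=
  ⟨(memLp_const (1 : ℂ)).toLp (fun _ => 1), fun σ => by
    have : (fun k : Fin 0 → Mom d => k ∘ σ) = id := Subsingleton.elim _ _
    refine Lp.ext ?_
    filter_upwards [Lp.coeFn_compMeasurePreserving
      ((memLp_const (1 : ℂ)).toLp (fun _ : Fin 0 → Mom d => (1 : ℂ)) : Lp ℂ 2 volume)
      (perm_measurePreserving σ)] with k hk
    rw [hk, this]
    rfl⟩

/-- The Fock vacuum `(1, 0, 0, …)`. -/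
def vacuum (d : ℕ) : Fock d := lp.single 2 0 (oneL2 d)

/-! ### Second quantization -/

/-- The graph of `dΓ(ϖ)`: pairs `(ψ, χ)` with
`χ_n(k_1, …, k_n) = (ϖ(k_1) + ⋯ + ϖ(k_n)) ψ_n(k_1, …, k_n)` for all `n`. -/
def secondQuantGraph (ϖ : Dispersion d) : Submodule ℂ (Fock d × Fock d) where
  carrier := {p | ∀ n : ℕ,
    ((p.2 n : Lp ℂ 2 (volume : Measure (Fin n → Mom d))) : (Fin n → Mom d) → ℂ) =ᵐ[volume]
      fun k => ((∑ j, ϖ.toFun (k j) : ℝ) : ℂ) * (p.1 n : Lp ℂ 2 volume) k}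
  zero_mem' n := by
    have h := Lp.coeFn_zero ℂ 2 (volume : Measure (Fin n → Mom d))
    filter_upwards [h] with k _
    change (0 : Lp ℂ 2 (volume : Measure (Fin n → Mom d))) k =
      _ * (0 : Lp ℂ 2 (volume : Measure (Fin n → Mom d))) k
    simp
  add_mem' {p q} hp hq n := by
    filter_upwards [hp n, hq n,
      Lp.coeFn_add (p.1 n : Lp ℂ 2 (volume : Measure (Fin n → Mom d))) (q.1 n),
      Lp.coeFn_add (p.2 n : Lp ℂ 2 (volume : Measure (Fin n → Mom d))) (q.2 n)] with k h1 h2 h3 h4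
    change ((p.2 n : Lp ℂ 2 (volume : Measure (Fin n → Mom d))) + (q.2 n : Lp ℂ 2 volume) :
        Lp ℂ 2 (volume : Measure (Fin n → Mom d))) k =
      _ * ((p.1 n : Lp ℂ 2 (volume : Measure (Fin n → Mom d))) + (q.1 n : Lp ℂ 2 volume) :
        Lp ℂ 2 (volume : Measure (Fin n → Mom d))) k
    rw [h3, h4, Pi.add_apply, Pi.add_apply, h1, h2]
    ring
  smul_mem' c p hp n := by
    filter_upwards [hp n,
      Lp.coeFn_smul c (p.1 n : Lp ℂ 2 (volume : Measure (Fin n → Mom d))),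
      Lp.coeFn_smul c (p.2 n : Lp ℂ 2 (volume : Measure (Fin n → Mom d)))] with k h1 h3 h4
    change (c • (p.2 n : Lp ℂ 2 (volume : Measure (Fin n → Mom d))) :
        Lp ℂ 2 (volume : Measure (Fin n → Mom d))) k =
      _ * (c • (p.1 n : Lp ℂ 2 (volume : Measure (Fin n → Mom d))) :
        Lp ℂ 2 (volume : Measure (Fin n → Mom d))) k
    rw [h3, h4, Pi.smul_apply, Pi.smul_apply, h1, smul_eq_mul, smul_eq_mul]
    ring

/-- The second quantization `dΓ(ϖ)`, an unbounded operator with its maximal domain. -/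
def secondQuant (ϖ : Dispersion d) : Fock d →ₗ.[ℂ] Fock d :=
  (secondQuantGraph ϖ).toLinearPMap

lemma secondQuant_graph (ϖ : Dispersion d) :
    (secondQuant ϖ).graph = secondQuantGraph ϖ := by
  refine Submodule.toLinearPMap_graph_eq _ ?_
  rintro ⟨ψ, χ⟩ h h0
  replace h0 : ψ = 0 := h0
  subst h0
  change χ = 0
  ext1
  funext n
  refine Subtype.ext (Lp.ext ?_)
  filter_upwards [h n, Lp.coeFn_zero ℂ 2 (volume : Measure (Fin n → Mom d))] with k h1 h2
  rw [h1]
  change _ * (0 : Lp ℂ 2 (volume : Measure (Fin n → Mom d))) k =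
    (0 : Lp ℂ 2 (volume : Measure (Fin n → Mom d))) k
  simp

/-- `V(t) = e^{itA}`: `V` is the strongly continuous one-parameter unitary group whose generator is
exactly the operator `A`, that is, `ψ` lies in the domain of `A` and `A ψ = χ` if and only if
`t ↦ V(t) ψ` is differentiable at `0` with derivative `i χ`. By Stone's theorem there is at most one
such group, and there is one if and only if `A` is self-adjoint. -/
structure IsUnitaryGroupOf {H : Type*} [NormedAddCommGroup H] [InnerProductSpace ℂ H]
    (A : H →ₗ.[ℂ] H) (V : ℝ → H ≃ₗᵢ[ℂ] H) : Prop where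
  map_zero : ∀ ψ, V 0 ψ = ψ
  map_add : ∀ s t ψ, V (s + t) ψ = V s (V t ψ)
  continuous : ∀ ψ, Continuous fun t => V t ψ
  generator : ∀ ψ χ, (ψ, χ) ∈ A.graph ↔ HasDerivAt (fun t : ℝ => V t ψ) (I • χ) 0

end VanHove

end

/-!
The Weyl algebra has a universal property: every family of unitaries `W'(f)` in a C*-algebra that
satisfies the Weyl relations receives a unique *-homomorphism with `W(f) ↦ W'(f)`
(`IsWeylSystem.exists_starAlgHom`, with uniqueness from `eq_of_eq_on_weyl`). Uniqueness is density
of the span of the `W(f)`. Existence amounts to the bound `‖b'‖ ≤ ‖b‖` for `b = ∑ c_f W(f)`,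
`b' = ∑ c_f W'(f)`, and by the C*-identity to the same bound for all powers of `a = b* b` and
`a' = b'* b'` up to a factor of polynomial growth. If `a` is a combination of `W(f)` with `f` in a
finite set `S`, then `a^n` is a combination of `W(g)` with `g` an `n`-fold sum from `S`, and the
number of such sums is polynomial in `n`. In the regular representation the squared norm of `a^n`
bounds the sum of the squares of its coefficients, so Cauchy-Schwarz gives
`‖a'^n‖² ≤ (polynomial in n) ‖a^n‖²`, and the polynomial disappears on taking `n`-th roots.

The dynamics follows at once, because `χ_t(f) W(e^{itϖ} f)` with the prescribed drift character
`χ_t` is again a Weyl system, and the group law can be checked on the `W(f)`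
(`existsUnique_dynamics`).

On Fock space one works with the coherent vectors `coherent g`, which are Gaussian multiples of
`∑ₙ c_n g^{⊗ n}` with `coherent 0` the vacuum. They are total
(`topologicalClosure_span_coherent`): a vector orthogonal to all of them is, comparing
coefficients of a power series, orthogonal to all `g^{⊗ n}`; by polarization and symmetry, to all
products of test functions; and these approximate indicators of boxes. A Weyl operator acts by
`coherent g ↦ χ(f) e^{-iπ² Im⟨f,g⟩} coherent (f + g)`: this map preserves the Gram matrix of the
coherent family, hence extends to a unitary (`exists_unitary_of_gram_eq`). With `χ(f) = e^{2πi
Re⟨f,-v/ϖ⟩}` one obtains a representation in which the vacuum is cyclic and has the prescribed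
expectation values (`exists_fockRep`). This gives existence of the state, and, since GNS
representations of one state are unitarily equivalent, its GNS representation (`exists_gns_fock`).

Multiplication by `e^{it(ϖ(k_1) + ⋯ + ϖ(k_n))}` is a unitary group that sends `coherent g` to
`coherent (e^{itϖ} g)`, and dominated convergence in one direction and almost everywhere
convergence of a subsequence of difference quotients in the other identify its generator as
`dΓ(ϖ)` with maximal domain (`Dispersion.isUnitaryGroupOf_fockUnitary`). The drift of the
dynamics is exactly the change of the character `χ` along the flow, so conjugation by the group implements the
dynamics on coherent vectors (`IsCoherentFamily.rep_dynamics`), and therefore everywhere.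
-/

noncomputable section

namespace VanHove

/-! ### Unitaries from Gram matrices -/

section Gram

variable {ι H K : Type*} [NormedAddCommGroup H] [InnerProductSpace ℂ H] [CompleteSpace H]
  [NormedAddCommGroup K] [InnerProductSpace ℂ K] [CompleteSpace K]

/-- A linear isometry on a complete space whose range contains a total family is onto. -/
lemma surjective_of_total {E F : Type*} [NormedAddCommGroup E] [NormedSpace ℂ E] [CompleteSpace E]
    [NormedAddCommGroup F] [NormedSpace ℂ F] (L : E →ₗᵢ[ℂ] F) {y : ι → F}
    (hy : (Submodule.span ℂ (Set.range y)).topologicalClosure = ⊤)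
    (h : ∀ i, ∃ x, L x = y i) : Function.Surjective L := by
  have hc : IsClosed (LinearMap.range L.toLinearMap : Set F) :=
    L.isometry.isClosedEmbedding.isClosed_range
  have hle : (Submodule.span ℂ (Set.range y)).topologicalClosure ≤
      LinearMap.range L.toLinearMap := by
    refine Submodule.topologicalClosure_minimal _ (Submodule.span_le.2 ?_) hc
    rintro _ ⟨i, rfl⟩
    exact h i
  intro z
  exact hle (hy ▸ Submodule.mem_top : z ∈ _)

/-- Two total families in Hilbert spaces with the same Gram matrix are unitarily equivalent. The
unitary is the closed span of the pairs `(x i, y i)`, seen as a graph. -/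
theorem exists_unitary_of_gram_eq (x : ι → H) (y : ι → K)
    (hx : (Submodule.span ℂ (Set.range x)).topologicalClosure = ⊤)
    (hy : (Submodule.span ℂ (Set.range y)).topologicalClosure = ⊤)
    (h : ∀ i j, inner ℂ (x i) (x j) = inner ℂ (y i) (y j)) :
    ∃ U : H ≃ₗᵢ[ℂ] K, ∀ i, U (x i) = y i := by
  let S : Submodule ℂ (H × K) := Submodule.span ℂ (Set.range fun i => (x i, y i))
  have hS : ∀ p ∈ S, ∀ q ∈ S, inner ℂ p.1 q.1 = inner ℂ p.2 q.2 := by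
    intro p hp q hq
    induction hp, hq using Submodule.span_induction₂ with
    | mem_mem p q hp hq =>
      obtain ⟨i, rfl⟩ := hp
      obtain ⟨j, rfl⟩ := hq
      exact h i j
    | zero_left => simp
    | zero_right => simp
    | add_left p q r _ _ _ h1 h2 => simp [h1, h2]
    | add_right p q r _ _ _ h1 h2 => simp [h1, h2]
    | smul_left c p q _ _ h1 => simp [h1]
    | smul_right c p q _ _ h1 => simp [h1]
  have hT : ∀ p ∈ S.topologicalClosure, ‖p.1‖ = ‖p.2‖ := by
    intro p hp
    have hcl : IsClosed {p : H × K | ‖p.1‖ = ‖p.2‖} :=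
      isClosed_eq continuous_fst.norm continuous_snd.norm
    refine hcl.closure_subset_iff.2 (fun q hq => ?_) hp
    change ‖q.1‖ = ‖q.2‖
    rw [@norm_eq_sqrt_re_inner ℂ, @norm_eq_sqrt_re_inner ℂ, hS q hq q hq]
  have : CompleteSpace S.topologicalClosure := S.isClosed_topologicalClosure.completeSpace_coe
  let L₁ : S.topologicalClosure →ₗᵢ[ℂ] H :=
    { (LinearMap.fst ℂ H K).comp S.topologicalClosure.subtype with
      norm_map' := fun p => by
        change ‖p.1.1‖ = max ‖p.1.1‖ ‖p.1.2‖
        rw [← hT p.1 p.2, max_self] }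
  let L₂ : S.topologicalClosure →ₗᵢ[ℂ] K :=
    { (LinearMap.snd ℂ H K).comp S.topologicalClosure.subtype with
      norm_map' := fun p => by
        change ‖p.1.2‖ = max ‖p.1.1‖ ‖p.1.2‖
        rw [hT p.1 p.2, max_self] }
  have hmem : ∀ i, (x i, y i) ∈ S.topologicalClosure := fun i =>
    S.le_topologicalClosure (Submodule.subset_span ⟨i, rfl⟩)
  let e₁ := LinearIsometryEquiv.ofSurjective L₁
    (surjective_of_total L₁ hx fun i => ⟨⟨_, hmem i⟩, rfl⟩)
  let e₂ := LinearIsometryEquiv.ofSurjective L₂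
    (surjective_of_total L₂ hy fun i => ⟨⟨_, hmem i⟩, rfl⟩)
  refine ⟨e₁.symm.trans e₂, fun i => ?_⟩
  have : e₁.symm (x i) = ⟨_, hmem i⟩ := by
    rw [LinearIsometryEquiv.symm_apply_eq]
    rfl
  change e₂ (e₁.symm (x i)) = y i
  rw [this]
  rfl

end Gram

/-! ### Weyl systems and the universal property of the Weyl algebra -/

variable {d : ℕ}

lemma symp_zero_left (f : Test d) : symp 0 f = 0 := by
  simpa using symp_add_left 0 0 f

lemma symp_zero_right (f : Test d) : symp f 0 = 0 := by
  simpa using symp_add_right f 0 0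

lemma symp_neg_right (f g : Test d) : symp f (-g) = -symp f g := by
  have h := symp_add_right f g (-g)
  rw [add_neg_cancel, symp_zero_right] at h
  linarith

@[simp] lemma weylPhase_zero_left (f : Test d) : weylPhase 0 f = 1 := by
  simp [weylPhase, symp_zero_left]

@[simp] lemma weylPhase_zero_right (f : Test d) : weylPhase f 0 = 1 := by
  simp [weylPhase, symp_zero_right]

@[simp] lemma weylPhase_neg_self (f : Test d) : weylPhase f (-f) = 1 := by
  simp [weylPhase, symp_neg_right, symp_self]

/-- A Weyl system in a *-algebra: a family satisfying the canonical commutation relations. -/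
structure IsWeylSystem {B : Type*} [Ring B] [StarRing B] [Algebra ℂ B] (w : Test d → B) :
    Prop where
  map_zero : w 0 = 1
  mul : ∀ f g, w f * w g = weylPhase f g • w (f + g)
  map_star : ∀ f, star (w f) = w (-f)

lemma isWeylSystem_weyl : IsWeylSystem (weyl (d := d)) where
  map_zero := Subtype.ext weylOp_zero
  mul := weyl_mul
  map_star := weyl_star

lemma isWeylSystem_weylOp : IsWeylSystem (weylOp (d := d)) where
  map_zero := weylOp_zero
  mul := weylOp_mul
  map_star f := congrArg Subtype.val (weyl_star f)

namespace IsWeylSystem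

section Algebra

variable {B : Type*} [Ring B] [StarRing B] [Algebra ℂ B] {w : Test d → B}

/-- Products of combinations of Weyl elements supported in `S` and `T` are supported in `S + T`. -/
lemma mul_mem_span (hw : IsWeylSystem w) {S T R : Set (Test d)}
    (h : ∀ f ∈ S, ∀ g ∈ T, f + g ∈ R) {p q : B} (hp : p ∈ Submodule.span ℂ (w '' S))
    (hq : q ∈ Submodule.span ℂ (w '' T)) : p * q ∈ Submodule.span ℂ (w '' R) := by
  induction hp, hq using Submodule.span_induction₂ with
  | mem_mem p q hp hq =>
    obtain ⟨f, hf, rfl⟩ := hp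
    obtain ⟨g, hg, rfl⟩ := hq
    rw [hw.mul]
    exact Submodule.smul_mem _ _ (Submodule.subset_span ⟨_, h f hf g hg, rfl⟩)
  | zero_left => simp
  | zero_right => simp
  | add_left p q r _ _ _ h1 h2 => rw [add_mul]; exact Submodule.add_mem _ h1 h2
  | add_right p q r _ _ _ h1 h2 => rw [mul_add]; exact Submodule.add_mem _ h1 h2
  | smul_left c p q _ _ h1 => rw [smul_mul_assoc]; exact Submodule.smul_mem _ _ h1
  | smul_right c p q _ _ h1 => rw [mul_smul_comm]; exact Submodule.smul_mem _ _ h1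

lemma star_mem_span [StarModule ℂ B] (hw : IsWeylSystem w) {p : B}
    (hp : p ∈ Submodule.span ℂ (Set.range w)) : star p ∈ Submodule.span ℂ (Set.range w) := by
  induction hp using Submodule.span_induction with
  | mem p hp =>
    obtain ⟨f, rfl⟩ := hp
    rw [hw.map_star]
    exact Submodule.subset_span ⟨_, rfl⟩
  | zero => simp
  | add p q _ _ h1 h2 => rw [star_add]; exact Submodule.add_mem _ h1 h2
  | smul c p _ h1 => rw [star_smul]; exact Submodule.smul_mem _ _ h1

/-- The *-algebra generated by a Weyl system is its linear span. -/
lemma adjoin_eq_span [StarModule ℂ B] (hw : IsWeylSystem w) :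
    (StarAlgebra.adjoin ℂ (Set.range w) : Set B) = Submodule.span ℂ (Set.range w) := by
  refine Set.Subset.antisymm (fun x hx => ?_) ?_
  · change x ∈ Submodule.span ℂ (Set.range w)
    induction hx using StarAlgebra.adjoin_induction with
    | mem x hx => exact Submodule.subset_span hx
    | algebraMap r =>
      rw [Algebra.algebraMap_eq_smul_one, ← hw.map_zero]
      exact Submodule.smul_mem _ _ (Submodule.subset_span ⟨0, rfl⟩)
    | add x y _ _ hx hy => exact Submodule.add_mem _ hx hy
    | mul x y _ _ hx hy =>
      rw [← Set.image_univ] at hx hy ⊢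
      exact hw.mul_mem_span (fun _ _ _ _ => Set.mem_univ _) hx hy
    | star x _ hx => exact hw.star_mem_span hx
  · have : Submodule.span ℂ (Set.range w) ≤
        Subalgebra.toSubmodule (StarAlgebra.adjoin ℂ (Set.range w)).toSubalgebra :=
      Submodule.span_le.2 (StarAlgebra.subset_adjoin ℂ _)
    exact this

lemma prodMk {C : Type*} [Ring C] [StarRing C] [Algebra ℂ C] {w' : Test d → C}
    (hw : IsWeylSystem w) (hw' : IsWeylSystem w') : IsWeylSystem fun f => (w f, w' f) where
  map_zero := Prod.ext hw.map_zero hw'.map_zero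
  mul f g := Prod.ext (hw.mul f g) (hw'.mul f g)
  map_star f := Prod.ext (hw.map_star f) (hw'.map_star f)

open scoped Classical in
/-- The combinations `∑ s ∈ S, m s • s` with natural coefficients `m s ≤ N`. -/
def multiples (S : Finset (Test d)) (N : ℕ) : Finset (Test d) :=
  (Fintype.piFinset fun _ : {s // s ∈ S} => Finset.range (N + 1)).image
    fun m => ∑ s : {s // s ∈ S}, m s • (s : Test d)

lemma card_multiples_le (S : Finset (Test d)) (N : ℕ) :
    (multiples S N).card ≤ (N + 1) ^ S.card := by
  classical
  refine Finset.card_image_le.trans ?_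
  simp

lemma zero_mem_multiples (S : Finset (Test d)) : 0 ∈ multiples S 0 := by
  classical
  exact Finset.mem_image.2 ⟨fun _ => 0, by simp, by simp⟩

lemma add_mem_multiples {S : Finset (Test d)} {N : ℕ} {f g : Test d} (hf : f ∈ multiples S N)
    (hg : g ∈ S) : f + g ∈ multiples S (N + 1) := by
  classical
  obtain ⟨m, hm, rfl⟩ := Finset.mem_image.1 hf
  refine Finset.mem_image.2 ⟨m + Pi.single ⟨g, hg⟩ 1, ?_, ?_⟩
  · rw [Fintype.mem_piFinset] at hm ⊢
    intro s
    have h1 := Finset.mem_range.1 (hm s)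
    have h2 : (Pi.single ⟨g, hg⟩ 1 : {s // s ∈ S} → ℕ) s ≤ 1 := by
      by_cases h : s = ⟨g, hg⟩
      · subst h; simp
      · simp [h]
    simp only [Finset.mem_range, Pi.add_apply]
    omega
  · simp only [Pi.add_apply, add_smul, Finset.sum_add_distrib]
    congr 1
    rw [Finset.sum_eq_single ⟨g, hg⟩]
    · simp
    · intro b _ hb
      simp [hb]
    · simp

/-- The `N`-th power of an element supported in `S` is supported in `multiples S N`, a set whose
cardinality grows polynomially with `N`. -/
lemma pow_mem_span (hw : IsWeylSystem w) {S : Finset (Test d)} {p : B}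
    (hp : p ∈ Submodule.span ℂ (w '' S)) (N : ℕ) :
    p ^ N ∈ Submodule.span ℂ (w '' multiples S N) := by
  induction N with
  | zero =>
    rw [pow_zero, ← hw.map_zero]
    exact Submodule.subset_span ⟨0, zero_mem_multiples S, rfl⟩
  | succ N ih =>
    rw [pow_succ]
    exact hw.mul_mem_span (fun _ hf _ hg => add_mem_multiples hf hg) ih hp

lemma exists_finset_mem_span {B : Type*} [AddCommGroup B] [Module ℂ B] {w : Test d → B} {x : B}
    (hx : x ∈ Submodule.span ℂ (Set.range w)) :
    ∃ S : Finset (Test d), x ∈ Submodule.span ℂ (w '' S) := by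
  classical
  rw [← Set.image_univ] at hx
  obtain ⟨T, hT, hx⟩ := Submodule.mem_span_finite_of_mem_span hx
  obtain ⟨S, -, rfl⟩ := Finset.subset_set_image_iff.1 hT
  exact ⟨S, by simpa using hx⟩

end Algebra

section CStar

variable {B : Type*} [CStarAlgebra B] {w : Test d → B}

lemma norm_le_one (hw : IsWeylSystem w) (f : Test d) : ‖w f‖ ≤ 1 := by
  have h : star (w f) * w f = 1 := by
    have := hw.mul (-f) f
    rw [hw.map_star, this, neg_add_cancel, hw.map_zero]
    have h2 := weylPhase_neg_self (-f)
    rw [neg_neg] at h2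
    rw [h2, one_smul]
  rcases subsingleton_or_nontrivial B with hB | hB
  · rw [Subsingleton.elim (w f) 0, norm_zero]
    exact zero_le_one
  · have h3 := CStarRing.norm_star_mul_self (x := w f)
    rw [h, CStarRing.norm_one] at h3
    nlinarith [norm_nonneg (w f)]

/-- Cauchy–Schwarz bound: on combinations of Weyl elements supported in `S`, any representation is
controlled by the regular one up to `√|S|`, because `∑ c_f W(f) δ_0 = ∑ c_f δ_f`. -/
lemma norm_sq_le_card (hw : IsWeylSystem w) {S : Finset (Test d)}
    {p : (RegSpace d →L[ℂ] RegSpace d) × B}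
    (hp : p ∈ Submodule.span ℂ ((fun f => (weylOp f, w f)) '' S)) :
    ‖p.2‖ ^ 2 ≤ S.card * ‖p.1‖ ^ 2 := by
  classical
  obtain ⟨c, rfl⟩ := Submodule.mem_span_image_finset_iff_exists_fun' ℂ |>.1 hp
  set x := (∑ i ∈ S, c i • (weylOp i, w i)).1 with hx
  have hx' : x = ∑ f ∈ S, c f • weylOp f := by
    simp [hx, Prod.fst_sum]
  have hy' : (∑ i ∈ S, c i • (weylOp i, w i)).2 = ∑ f ∈ S, c f • w f := by
    simp [Prod.snd_sum]
  have h1 : ‖∑ f ∈ S, c f • w f‖ ≤ ∑ f ∈ S, ‖c f‖ := by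
    refine (norm_sum_le _ _).trans (Finset.sum_le_sum fun f _ => ?_)
    rw [norm_smul]
    exact mul_le_of_le_one_right (norm_nonneg _) (hw.norm_le_one f)
  let δ : RegSpace d := lp.single 2 (0 : Test d) (1 : ℂ)
  have hδ : ‖δ‖ = 1 := by
    rw [lp.norm_single (by norm_num)]
    simp
  have happ : ∀ g ∈ S, (x δ) g = c g := by
    intro g hg
    have : (x δ) g = ∑ f ∈ S, c f * (weylOp f δ) g := by
      rw [hx', _root_.sum_apply, lp.coeFn_sum, Finset.sum_apply]
      rfl
    rw [this, Finset.sum_eq_single g]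
    · rw [weylOp_apply, sub_self]
      simp [δ, weylPhase, symp_self]
    · intro f _ hfg
      rw [weylOp_apply]
      have h0 : g - f ≠ 0 := sub_ne_zero.2 hfg.symm
      simp [δ, h0]
    · exact fun h => absurd hg h
  have h2 : ∑ f ∈ S, ‖c f‖ ^ 2 ≤ ‖x‖ ^ 2 := by
    have h3 := lp.sum_rpow_le_norm_rpow (p := 2) (by norm_num) (x δ) S
    have h4 : ‖x δ‖ ≤ ‖x‖ := by simpa [hδ] using x.le_opNorm δ
    have h5 : ∑ f ∈ S, ‖c f‖ ^ 2 = ∑ f ∈ S, ‖(x δ) f‖ ^ (2 : ENNReal).toReal := by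
      refine Finset.sum_congr rfl fun f hf => ?_
      rw [happ f hf]
      norm_num
    rw [h5]
    refine h3.trans ?_
    norm_num
    gcongr
  rw [hy']
  calc ‖∑ f ∈ S, c f • w f‖ ^ 2 ≤ (∑ f ∈ S, ‖c f‖) ^ 2 := by gcongr
    _ ≤ S.card * ∑ f ∈ S, ‖c f‖ ^ 2 := sq_sum_le_card_mul_sum_sq
    _ ≤ _ := by gcongr

/-- A factor of polynomial growth in the exponent does not affect the comparison of the bases. Only
exponents `2 ^ m` are needed, as these suit the C*-identity. -/
lemma _root_.le_of_pow_two_pow_le {a b : ℝ} (ha : 0 ≤ a) (k : ℕ)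
    (h : ∀ m : ℕ, (b ^ 2 ^ m) ^ 2 ≤ ((2 ^ m : ℕ) + 1 : ℝ) ^ k * (a ^ 2 ^ m) ^ 2) : b ≤ a := by
  by_contra! hlt
  have hb0 : 0 < b := ha.trans_lt hlt
  set r := a / b with hr
  have hr0 : 0 ≤ r := by positivity
  have hr1 : r < 1 := (div_lt_one hb0).2 hlt
  have hlim := tendsto_pow_const_mul_const_pow_of_abs_lt_one k
    (r := r) (by rwa [abs_of_nonneg hr0])
  have hsub : Filter.Tendsto (fun m : ℕ => 2 ^ m * 2) Filter.atTop Filter.atTop :=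
    (tendsto_pow_atTop_atTop_of_one_lt one_lt_two).atTop_mul_const' two_pos
  have hlim2 := hlim.comp hsub
  have hge : ∀ m : ℕ, 1 ≤ (((2 ^ m * 2 : ℕ) : ℝ)) ^ k * r ^ (2 ^ m * 2) := by
    intro m
    have h2 : r ^ (2 ^ m * 2) = (a ^ 2 ^ m) ^ 2 / (b ^ 2 ^ m) ^ 2 := by
      rw [hr, div_pow, pow_mul, pow_mul]
    have h3 : (1 : ℝ) ≤ ((2 ^ m : ℕ) + 1 : ℝ) ^ k * r ^ (2 ^ m * 2) := by
      rw [h2, mul_div_assoc', le_div_iff₀ (by positivity), one_mul]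
      exact h m
    refine h3.trans ?_
    gcongr
    have : (1 : ℝ) ≤ (2 ^ m : ℕ) := by exact_mod_cast Nat.one_le_two_pow
    push_cast at this ⊢
    linarith
  exact absurd (ge_of_tendsto' hlim2 hge) (by norm_num)

/-- By the C*-identity, a comparison of the norms of the powers `(p* p)^N` of a pair, up to a factor
growing polynomially with `N`, yields a comparison of the norms. -/
lemma _root_.norm_snd_le_norm_fst_of_pow {A B : Type*} [CStarAlgebra A] [CStarAlgebra B]
    (p : A × B) (k : ℕ) (h : ∀ m : ℕ, ‖((star p * p) ^ 2 ^ m).2‖ ^ 2 ≤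
      ((2 ^ m : ℕ) + 1 : ℝ) ^ k * ‖((star p * p) ^ 2 ^ m).1‖ ^ 2) : ‖p.2‖ ≤ ‖p.1‖ := by
  have hab : ‖star p.2 * p.2‖ ≤ ‖star p.1 * p.1‖ := by
    refine le_of_pow_two_pow_le (norm_nonneg _) k fun m => ?_
    have h1 := h m
    have h2 : ‖((star p * p) ^ 2 ^ m).1‖ = ‖star p.1 * p.1‖ ^ 2 ^ m :=
      congrArg NNReal.toReal ((IsSelfAdjoint.star_mul_self p.1).nnnorm_pow_two_pow m)
    have h3 : ‖((star p * p) ^ 2 ^ m).2‖ = ‖star p.2 * p.2‖ ^ 2 ^ m :=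
      congrArg NNReal.toReal ((IsSelfAdjoint.star_mul_self p.2).nnnorm_pow_two_pow m)
    rwa [h2, h3] at h1
  rw [CStarRing.norm_star_mul_self, CStarRing.norm_star_mul_self] at hab
  exact abs_le_of_sq_le_sq' (by simpa only [sq] using hab) (norm_nonneg _) |>.2

/-- Any Weyl system is dominated in norm by the regular one: the factor in `norm_sq_le_card` may be
applied to `(p* p)^N`, whose support grows polynomially with `N`, and disappears after taking `N`-th
roots. -/
lemma norm_snd_le_norm_fst (hw : IsWeylSystem w) {p : (RegSpace d →L[ℂ] RegSpace d) × B}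
    (hp : p ∈ StarAlgebra.adjoin ℂ (Set.range fun f => (weylOp f, w f))) : ‖p.2‖ ≤ ‖p.1‖ := by
  have hw2 := isWeylSystem_weylOp.prodMk hw
  have hq : star p * p ∈ (StarAlgebra.adjoin ℂ (Set.range fun f => (weylOp f, w f)) : Set _) :=
    mul_mem (star_mem hp) hp
  rw [hw2.adjoin_eq_span] at hq
  obtain ⟨S, hS⟩ := exists_finset_mem_span hq
  refine norm_snd_le_norm_fst_of_pow p S.card fun m => ?_
  refine (hw.norm_sq_le_card (hw2.pow_mem_span hS (2 ^ m))).trans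
    (mul_le_mul_of_nonneg_right ?_ (sq_nonneg _))
  exact_mod_cast card_multiples_le S (2 ^ m)

/-- Universal property: a Weyl system in a C*-algebra extends to a representation of the Weyl
algebra. The norm closure of the *-algebra generated by the pairs `(W(f), w(f))` is the graph of
the representation. -/
theorem exists_starAlgHom (hw : IsWeylSystem w) :
    ∃ π : WeylAlgebra d →⋆ₐ[ℂ] B, ∀ f, π (weyl f) = w f := by
  let A := RegSpace d →L[ℂ] RegSpace d
  let C₀ : StarSubalgebra ℂ (A × B) := StarAlgebra.adjoin ℂ (Set.range fun f => (weylOp f, w f))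
  let C : StarSubalgebra ℂ (A × B) := C₀.topologicalClosure
  have hC : IsClosed (C : Set (A × B)) := StarSubalgebra.isClosed_topologicalClosure _
  have hle : ∀ p ∈ C, ‖p.2‖ ≤ ‖p.1‖ := fun p hp =>
    (isClosed_le continuous_snd.norm continuous_fst.norm).closure_subset_iff.2
      (fun q hq => hw.norm_snd_le_norm_fst hq) hp
  have hmem : ∀ f, (weylOp f, w f) ∈ C := fun f =>
    StarSubalgebra.le_topologicalClosure _ (StarAlgebra.subset_adjoin ℂ _ ⟨f, rfl⟩)
  let W : StarSubalgebra ℂ A :=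
    (StarAlgebra.adjoin ℂ (Set.range (weylOp (d := d)))).topologicalClosure
  have hfst : ∀ p ∈ C, p.1 ∈ W := by
    have h0 : C₀ ≤ W.comap (StarAlgHom.fst ℂ A B) := by
      refine StarAlgebra.adjoin_le ?_
      rintro _ ⟨f, rfl⟩
      exact (weyl f).2
    have hcl : IsClosed (W.comap (StarAlgHom.fst ℂ A B) : Set (A × B)) :=
      (weylClosed d).preimage continuous_fst
    exact fun p hp => StarSubalgebra.topologicalClosure_minimal h0 hcl hp
  let Φ : C →⋆ₐ[ℂ] W := ((StarAlgHom.fst ℂ A B).comp C.subtype).codRestrict W fun p => hfst _ p.2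
  have hΦ : ∀ p : C, ‖Φ p‖ = ‖p‖ := fun p => (max_eq_left (hle p.1 p.2)).symm
  have hiso : Isometry Φ := AddMonoidHomClass.isometry_of_norm Φ hΦ
  have : CompleteSpace C := hC.completeSpace_coe
  have hsurj : Function.Surjective Φ := by
    have hcl : IsClosed (Set.range fun p => (Φ p : A)) :=
      (isometry_subtype_coe.comp hiso).isClosedEmbedding.isClosed_range
    have hsub : W ≤ (W.subtype.comp Φ).range := by
      refine StarSubalgebra.topologicalClosure_minimal (StarAlgebra.adjoin_le ?_) ?_
      · rintro _ ⟨f, rfl⟩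
        exact ⟨⟨_, hmem f⟩, rfl⟩
      · have : ((W.subtype.comp Φ).range : Set A) = Set.range fun p => (Φ p : A) := by
          ext
          rfl
        rw [this]
        exact hcl
    intro a
    obtain ⟨p, hp⟩ := hsub a.2
    exact ⟨p, Subtype.ext hp⟩
  -- the graph projects bijectively to the Weyl algebra, because the second component is dominated
  let e : C ≃⋆ₐ[ℂ] W := StarAlgEquiv.ofBijective Φ ⟨hiso.injective, hsurj⟩
  let π : W →⋆ₐ[ℂ] B := ((StarAlgHom.snd ℂ A B).comp C.subtype).comp (e.symm : W →⋆ₐ[ℂ] C)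
  refine ⟨π, fun f => ?_⟩
  have : e.symm (weyl f) = ⟨_, hmem f⟩ := by
    refine (StarAlgEquiv.symm_apply_eq e).2 ?_
    rfl
  change ((e.symm (weyl f) : C) : A × B).2 = w f
  rw [this]

end CStar

end IsWeylSystem

variable {d : ℕ}

/-! ### Density of the Weyl operators -/

lemma topologicalClosure_span_weyl :
    (Submodule.span ℂ (Set.range (weyl (d := d)))).topologicalClosure = ⊤ := by
  let ι : WeylAlgebra d →ₗ[ℂ] (RegSpace d →L[ℂ] RegSpace d) :=
    { toFun := fun a => a.1
      map_add' := fun _ _ => rfl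
      map_smul' := fun _ _ => rfl }
  have hmap : (Submodule.span ℂ (Set.range (weyl (d := d)))).map ι =
      Submodule.span ℂ (Set.range weylOp) := by
    rw [Submodule.map_span, ← Set.range_comp]
    rfl
  have hι : Topology.IsInducing ι := Topology.IsInducing.subtypeVal
  refine top_unique fun a _ => ?_
  change a ∈ closure (Submodule.span ℂ (Set.range (weyl (d := d))) : Set (WeylAlgebra d))
  rw [hι.closure_eq_preimage_closure_image, ← Submodule.map_coe, hmap,
    ← isWeylSystem_weylOp.adjoin_eq_span]
  exact a.2

/-- Continuous linear maps on the Weyl algebra are determined by their values on the `W(f)`. -/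
lemma eq_of_eq_on_weyl {E : Type*} [AddCommGroup E] [Module ℂ E] [TopologicalSpace E] [T2Space E]
    (F G : WeylAlgebra d →ₗ[ℂ] E) (hF : Continuous F) (hG : Continuous G)
    (h : ∀ f, F (weyl f) = G (weyl f)) (a : WeylAlgebra d) : F a = G a := by
  have ha : a ∈ closure (Submodule.span ℂ (Set.range (weyl (d := d))) : Set (WeylAlgebra d)) := by
    have : a ∈ (Submodule.span ℂ (Set.range (weyl (d := d)))).topologicalClosure :=
      topologicalClosure_span_weyl ▸ Submodule.mem_top
    exact this
  refine (isClosed_eq hF hG).closure_subset_iff.2 (fun b hb => ?_) ha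
  change F b = G b
  induction hb using Submodule.span_induction with
  | mem x hx => obtain ⟨f, rfl⟩ := hx; exact h f
  | zero => simp
  | add x y _ _ hx hy => rw [map_add, map_add, hx, hy]
  | smul c x _ hx => rw [map_smul, map_smul, hx]

/-! ### Characters and symplectic transformations -/

/-- The character `f ↦ e^{2πi Re⟨f, T⟩}` of the additive group of test functions. -/
def weylChar (T : Test d →ₗ[ℂ] ℂ) (f : Test d) : ℂ :=
  exp (2 * Real.pi * I * ((bracket f T).re : ℂ))

lemma conjTest_add (f g : Test d) : conjTest (f + g) = conjTest f + conjTest g :=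
  map_add _ f g

lemma conjTest_neg (f : Test d) : conjTest (-f) = -conjTest f :=
  map_neg _ f

lemma weylChar_add (T : Test d →ₗ[ℂ] ℂ) (f g : Test d) :
    weylChar T (f + g) = weylChar T f * weylChar T g := by
  simp only [weylChar, bracket, conjTest_add, map_add, add_re, ofReal_add, ← Complex.exp_add]
  congr 1
  ring

lemma weylChar_zero (T : Test d →ₗ[ℂ] ℂ) : weylChar T 0 = 1 := by
  have h : conjTest (0 : Test d) = 0 := map_zero _
  simp [weylChar, bracket, h]

lemma weylChar_ne_zero (T : Test d →ₗ[ℂ] ℂ) (f : Test d) : weylChar T f ≠ 0 := exp_ne_zero _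

lemma star_weylChar (T : Test d →ₗ[ℂ] ℂ) (f : Test d) :
    star (weylChar T f) = weylChar T (-f) := by
  simp only [weylChar, bracket, conjTest_neg, map_neg, neg_re, ofReal_neg]
  rw [star_def, ← Complex.exp_conj]
  simp [conj_ofNat]

/-- A Weyl system twisted by a character and a linear symplectic map is a Weyl system. -/
lemma IsWeylSystem.twist {B : Type*} [Ring B] [StarRing B] [Algebra ℂ B] [StarModule ℂ B]
    {w : Test d → B} (hw : IsWeylSystem w) (T : Test d →ₗ[ℂ] ℂ) (L : Test d →ₗ[ℂ] Test d)
    (hL : ∀ f g, symp (L f) (L g) = symp f g) :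
    IsWeylSystem fun f => weylChar T f • w (L f) where
  map_zero := by rw [weylChar_zero, _root_.map_zero, hw.map_zero, one_smul]
  mul f g := by
    have : weylPhase (L f) (L g) = weylPhase f g := by rw [weylPhase, hL, weylPhase]
    rw [smul_mul_smul_comm, hw.mul, this, map_add, weylChar_add, smul_comm]
  map_star f := by rw [star_smul, star_weylChar, hw.map_star, map_neg]

/-! ### The van Hove dynamics -/

namespace Dispersion

variable (ϖ : Dispersion d)

lemma phase_add (s t : ℝ) (k : Mom d) : ϖ.phase (s + t) k = ϖ.phase s k * ϖ.phase t k := by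
  simp only [phase, ← Complex.exp_add]
  congr 1
  push_cast
  ring

@[simp] lemma phase_zero (k : Mom d) : ϖ.phase 0 k = 1 := by simp [phase]

lemma conj_phase (t : ℝ) (k : Mom d) : (starRingEnd ℂ) (ϖ.phase t k) = ϖ.phase (-t) k := by
  simp only [phase, ← Complex.exp_conj]
  simp

lemma evolve_apply (t : ℝ) (f : Test d) (k : Mom d) : ϖ.evolve t f k = ϖ.phase t k * f k := rfl

lemma evolve_add (s t : ℝ) (f : Test d) : ϖ.evolve (s + t) f = ϖ.evolve s (ϖ.evolve t f) := by
  ext k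
  simp only [evolve_apply, phase_add, mul_assoc]

lemma evolve_zero (f : Test d) : ϖ.evolve 0 f = f := by
  ext k
  simp [evolve_apply]

lemma testInner_evolve (t : ℝ) (f g : Test d) :
    testInner (ϖ.evolve t f) (ϖ.evolve t g) = testInner f g := by
  unfold testInner
  congr 1
  ext k
  have h : (starRingEnd ℂ) (ϖ.phase t k) * ϖ.phase t k = 1 := by
    rw [conj_phase, ← phase_add, neg_add_cancel, phase_zero]
  rw [evolve_apply, evolve_apply, map_mul]
  linear_combination (starRingEnd ℂ) (f k) * g k * h

lemma symp_evolve (t : ℝ) (f g : Test d) : symp (ϖ.evolve t f) (ϖ.evolve t g) = symp f g := by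
  rw [symp, testInner_evolve, symp]

lemma conjTest_evolve (t : ℝ) (f : Test d) :
    conjTest (ϖ.evolve t f) = ϖ.evolve (-t) (conjTest f) := by
  ext k
  simp only [conjTest_apply, evolve_apply, map_mul, conj_phase]

/-- `⟨f, (e^{-itϖ} - 1) v/ϖ⟩ = ⟨e^{itϖ} f, v/ϖ⟩ - ⟨f, v/ϖ⟩`. -/
lemma bracket_driftSource (v : Dist d) (t : ℝ) (f : Test d) :
    bracket f (ϖ.driftSource v t) =
      bracket (ϖ.evolve t f) (ϖ.divSource v) - bracket f (ϖ.divSource v) := by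
  rw [bracket, bracket, bracket, conjTest_evolve, ← map_sub]
  change ϖ.divSource v _ = _
  congr 1
  ext k
  change (ϖ.phase (-t) k - 1) * conjTest f k = ϖ.phase (-t) k * conjTest f k - conjTest f k
  ring

lemma weylChar_driftSource_mul (v : Dist d) (t : ℝ) (f : Test d) :
    weylChar (ϖ.driftSource v t) f * weylChar (ϖ.divSource v) f =
      weylChar (ϖ.divSource v) (ϖ.evolve t f) := by
  simp only [weylChar, bracket_driftSource, ← Complex.exp_add, sub_re, ofReal_sub]
  congr 1
  ring

/-- The cocycle identity of the drift characters. -/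
lemma weylChar_driftSource_add (v : Dist d) (s t : ℝ) (f : Test d) :
    weylChar (ϖ.driftSource v (s + t)) f =
      weylChar (ϖ.driftSource v t) f * weylChar (ϖ.driftSource v s) (ϖ.evolve t f) := by
  refine mul_right_cancel₀ (weylChar_ne_zero (ϖ.divSource v) f) ?_
  rw [weylChar_driftSource_mul, mul_right_comm, weylChar_driftSource_mul, mul_comm,
    weylChar_driftSource_mul, evolve_add]

lemma weylChar_driftSource_zero (v : Dist d) (f : Test d) :
    weylChar (ϖ.driftSource v 0) f = 1 := by
  refine mul_right_cancel₀ (weylChar_ne_zero (ϖ.divSource v) f) ?_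
  rw [weylChar_driftSource_mul, evolve_zero, one_mul]

end Dispersion

lemma continuous_starAlgHom {B : Type*} [CStarAlgebra B] (φ : WeylAlgebra d →⋆ₐ[ℂ] B) :
    Continuous φ :=
  (NonUnitalStarAlgHom.instContinuousLinearMapClassComplex).map_continuous φ

/-- The dynamics exists by the universal property, since the Weyl elements twisted by `e^{itϖ}` and
the drift character form a Weyl system. The group law and
uniqueness need only be checked on Weyl elements, by density of their span. -/
theorem existsUnique_dynamics (ϖ : Dispersion d) (v : Dist d) :
    ∃! τ : ℝ → WeylAlgebra d ≃⋆ₐ[ℂ] WeylAlgebra d, IsVanHoveDynamics ϖ v τ := by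
  have hex : ∀ t : ℝ, ∃ φ : WeylAlgebra d →⋆ₐ[ℂ] WeylAlgebra d,
      ∀ f, φ (weyl f) = weylChar (ϖ.driftSource v t) f • weyl (ϖ.evolve t f) := fun t =>
    (isWeylSystem_weyl.twist (ϖ.driftSource v t) (ϖ.evolve t)
      (ϖ.symp_evolve t)).exists_starAlgHom
  choose φ hφ using hex
  have hadd : ∀ s t a, φ (s + t) a = φ s (φ t a) := by
    intro s t
    refine eq_of_eq_on_weyl (φ (s + t)).toAlgHom.toLinearMap
      ((φ s).comp (φ t)).toAlgHom.toLinearMap (continuous_starAlgHom _) (continuous_starAlgHom _)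
      fun f => ?_
    change φ (s + t) (weyl f) = φ s (φ t (weyl f))
    rw [hφ, hφ, map_smul, hφ, smul_smul, ϖ.weylChar_driftSource_add, ϖ.evolve_add]
  have hzero : ∀ a, φ 0 a = a := by
    refine eq_of_eq_on_weyl (φ 0).toAlgHom.toLinearMap LinearMap.id (continuous_starAlgHom _)
      continuous_id fun f => ?_
    change φ 0 (weyl f) = weyl f
    rw [hφ, ϖ.weylChar_driftSource_zero, ϖ.evolve_zero, one_smul]
  have hinv : ∀ t a, φ t (φ (-t) a) = a := fun t a => by
    rw [← hadd, add_neg_cancel, hzero]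
  let τ : ℝ → WeylAlgebra d ≃⋆ₐ[ℂ] WeylAlgebra d := fun t =>
    StarAlgEquiv.ofBijective (φ t)
      ⟨Function.LeftInverse.injective (g := φ (-t)) fun a => by simpa using hinv (-t) a,
        fun a => ⟨φ (-t) a, hinv t a⟩⟩
  refine ⟨τ, ⟨hzero, hadd, fun t => ?_, hφ⟩, fun τ' hτ' => funext fun t => ?_⟩
  · exact NonUnitalStarAlgHom.isometry (φ t) (τ t).injective
  · refine StarAlgEquiv.ext fun a => ?_
    refine eq_of_eq_on_weyl ((τ' t : WeylAlgebra d →⋆ₐ[ℂ] WeylAlgebra d)).toAlgHom.toLinearMap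
      (φ t).toAlgHom.toLinearMap (hτ'.isometry t).continuous (continuous_starAlgHom _)
      (fun f => ?_) a
    exact (hτ'.map_weyl t f).trans (hφ t f).symm

/-! ### Product functions and coherent vectors -/

lemma continuous_prod_test {n : ℕ} (f : Fin n → Test d) :
    Continuous fun k : Fin n → Mom d => ∏ j, f j (k j) :=
  continuous_finsetProd _ fun j _ => (f j).continuous.comp (continuous_apply j)

lemma hasCompactSupport_prod_test {n : ℕ} (f : Fin n → Test d) :
    HasCompactSupport fun k : Fin n → Mom d => ∏ j, f j (k j) := by
  refine HasCompactSupport.intro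
    (isCompact_univ_pi fun j => (f j).hasCompactSupport.isCompact) fun k hk => ?_
  simp only [Set.mem_pi, Set.mem_univ, true_implies, not_forall] at hk
  obtain ⟨j, hj⟩ := hk
  exact Finset.prod_eq_zero (Finset.mem_univ j) (image_eq_zero_of_notMem_tsupport hj)

lemma memLp_prod_test {n : ℕ} (f : Fin n → Test d) :
    MemLp (fun k : Fin n → Mom d => ∏ j, f j (k j)) 2 volume :=
  (continuous_prod_test f).memLp_of_hasCompactSupport (hasCompactSupport_prod_test f)

/-- The class of `(k_1, …, k_n) ↦ f_1(k_1) ⋯ f_n(k_n)` in `L²`. -/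
def prodL2 {n : ℕ} (f : Fin n → Test d) : Lp ℂ 2 (volume : Measure (Fin n → Mom d)) :=
  (memLp_prod_test f).toLp _

lemma coeFn_prodL2 {n : ℕ} (f : Fin n → Test d) :
    prodL2 f =ᵐ[volume] fun k => ∏ j, f j (k j) :=
  (memLp_prod_test f).coeFn_toLp

/-- The tensor power `f^{⊗n}`. -/
def tensorPow (n : ℕ) (f : Test d) : symL2 d n :=
  ⟨prodL2 fun _ => f, fun σ => by
    rw [prodL2, Lp.toLp_compMeasurePreserving]
    congr 1
    ext k
    exact Equiv.prod_comp σ fun j => f (k j)⟩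

lemma inner_tensorPow (n : ℕ) (f g : Test d) :
    inner ℂ (tensorPow n f) (tensorPow n g) = testInner f g ^ n := by
  change inner ℂ (prodL2 fun _ => f) (prodL2 fun _ => g) = _
  rw [L2.inner_def, testInner, ← Fintype.card_fin n]
  rw [← integral_fintype_prod_volume_eq_pow (ι := Fin n)
    (fun k => (starRingEnd ℂ) (f k) * g k), Fintype.card_fin]
  refine integral_congr_ae ?_
  filter_upwards [coeFn_prodL2 (n := n) fun _ => f, coeFn_prodL2 (n := n) fun _ => g]
    with k hf hg
  rw [hf, hg, RCLike.inner_apply, map_prod, ← Finset.prod_mul_distrib]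
  exact Finset.prod_congr rfl fun _ _ => mul_comm _ _

/-- The coefficient `π^n / √(n!)` of the exponential vectors. -/
def expCoeff (n : ℕ) : ℝ := Real.pi ^ n / √(n.factorial : ℝ)

lemma expCoeff_sq (n : ℕ) : expCoeff n ^ 2 = (Real.pi ^ 2) ^ n / n.factorial := by
  rw [expCoeff, div_pow, Real.sq_sqrt (by positivity), ← pow_mul, ← pow_mul, mul_comm]

lemma memℓp_expVec (f : Test d) :
    Memℓp (fun n : ℕ => (expCoeff n : ℂ) • tensorPow n f) 2 := by
  refine memℓp_gen ?_
  have h : ∀ n : ℕ, ‖(expCoeff n : ℂ) • tensorPow n f‖ ^ (2 : ENNReal).toReal =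
      (Real.pi ^ 2 * ‖testInner f f‖) ^ n / n.factorial := by
    intro n
    have h1 : ‖tensorPow n f‖ ^ 2 = ‖testInner f f‖ ^ n := by
      rw [← norm_pow, ← inner_tensorPow, inner_self_eq_norm_sq_to_K (𝕜 := ℂ) (tensorPow n f)]
      simp
    rw [ENNReal.toReal_ofNat, Real.rpow_ofNat, norm_smul (expCoeff n : ℂ) (tensorPow n f),
      mul_pow, h1, norm_real, Real.norm_eq_abs, sq_abs, expCoeff_sq, mul_pow]
    ring
  simp_rw [h]
  exact Real.summable_pow_div_factorial _

/-- The exponential vector `∑_n (π^n / √(n!)) f^{⊗n}`. -/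
def expVec (f : Test d) : Fock d := ⟨fun n => (expCoeff n : ℂ) • tensorPow n f, memℓp_expVec f⟩

lemma expVec_apply (f : Test d) (n : ℕ) : expVec f n = (expCoeff n : ℂ) • tensorPow n f := rfl

lemma inner_expVec (f g : Test d) :
    inner ℂ (expVec f) (expVec g) = exp (Real.pi ^ 2 * testInner f g) := by
  refine (lp.hasSum_inner (𝕜 := ℂ) (expVec f) (expVec g)).unique ?_
  rw [Complex.exp_eq_exp_ℂ]
  convert! NormedSpace.expSeries_div_hasSum_exp (𝔸 := ℂ) (Real.pi ^ 2 * testInner f g) using 1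
  ext n
  rw [expVec_apply, expVec_apply, inner_smul_left (𝕜 := ℂ) (tensorPow n f),
    inner_smul_right (𝕜 := ℂ) (tensorPow n f) (tensorPow n g), inner_tensorPow, conj_ofReal,
    ← mul_assoc, ← ofReal_mul, ← sq, expCoeff_sq]
  push_cast
  ring

/-- The normalization `e^{-π²⟨f,f⟩/2}`. -/
def gauss (f : Test d) : ℂ := exp (-(Real.pi ^ 2 / 2) * testInner f f)

lemma conj_gauss (f : Test d) : (starRingEnd ℂ) (gauss f) = gauss f := by
  rw [gauss, ← Complex.exp_conj, map_mul, testInner_conj]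
  simp [conj_ofNat]

/-- The coherent vector `e^{-π²⟨f,f⟩/2} ∑_n (π^n / √(n!)) f^{⊗n}`; this is `W(f) Ω` in the Fock
representation. -/
def coherent (f : Test d) : Fock d := gauss f • expVec f

lemma inner_coherent (f g : Test d) : inner ℂ (coherent f) (coherent g) =
    exp (-(Real.pi ^ 2 / 2) * (testInner f f + testInner g g) + Real.pi ^ 2 * testInner f g) := by
  rw [coherent, coherent, inner_smul_left, inner_smul_right, conj_gauss, inner_expVec, gauss, gauss,
    ← Complex.exp_add, ← Complex.exp_add]
  congr 1
  ring

lemma testInner_zero_left (f : Test d) : testInner 0 f = 0 := by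
  simpa using testInner_add_left 0 0 f

lemma coherent_zero : coherent (0 : Test d) = vacuum d := by
  have h : gauss (0 : Test d) = 1 := by simp [gauss, testInner_zero_left]
  rw [coherent, h, one_smul]
  ext1
  funext n
  rw [expVec_apply, vacuum]
  rcases Nat.eq_zero_or_pos n with rfl | hn
  · rw [lp.single_apply_self]
    simp only [expCoeff, pow_zero, Nat.factorial_zero, Nat.cast_one, Real.sqrt_one, div_one,
      ofReal_one, one_smul]
    refine Subtype.ext (Lp.ext ?_)
    filter_upwards [coeFn_prodL2 fun _ : Fin 0 => (0 : Test d),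
      (memLp_const (μ := (volume : Measure (Fin 0 → Mom d))) (p := 2) (1 : ℂ)).coeFn_toLp]
      with k h1 h2
    change prodL2 (fun _ : Fin 0 => (0 : Test d)) k = _
    rw [h1]
    simp only [Finset.univ_eq_empty, Finset.prod_empty]
    exact h2.symm
  · rw [lp.single_apply_ne _ _ _ hn.ne']
    have : tensorPow n (0 : Test d) = 0 := by
      rw [← inner_self_eq_zero (𝕜 := ℂ), inner_tensorPow, testInner_zero_left, zero_pow hn.ne']
    rw [this, smul_zero]

/-- The Gram matrix of the coherent vectors is invariant under translation by `f` combined with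
multiplication by the phases `e^{-iπ² Im⟨f,g⟩}`. -/
lemma inner_coherent_add (f g h : Test d) :
    inner ℂ (weylPhase f g • coherent (f + g)) (weylPhase f h • coherent (f + h)) =
      inner ℂ (coherent g) (coherent h) := by
  rw [inner_smul_left, inner_smul_right, inner_coherent, inner_coherent, weylPhase, weylPhase,
    ← Complex.exp_conj, ← Complex.exp_add, ← Complex.exp_add]
  congr 1
  have key : ∀ u w : Test d, testInner u w - testInner w u = 2 * I * (symp u w : ℝ) := by
    intro u w
    rw [← testInner_conj u w, sub_conj, symp]
    push_cast
    ring
  have h1 := key f g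
  have h2 := key f h
  simp only [testInner_add_left, testInner_add_right, map_mul, map_neg, conj_I, conj_ofReal]
  push_cast
  linear_combination (-(Real.pi : ℂ) ^ 2 / 2) * h1 + ((Real.pi : ℂ) ^ 2 / 2) * h2

/-! ### Totality of the coherent vectors -/

/-- The indicator function of a bounded open set is a pointwise limit of test functions below it. -/
lemma exists_test_tendsto_indicator {U : Set (Mom d)} (hU : IsOpen U)
    (hb : Bornology.IsBounded U) :
    ∃ θ : ℕ → Test d, (∀ m k, ‖θ m k‖ ≤ U.indicator (fun _ => (1 : ℝ)) k) ∧
      ∀ k, Filter.Tendsto (fun m => θ m k) Filter.atTop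
        (nhds (U.indicator (fun _ => (1 : ℂ)) k)) := by
  obtain ⟨φ, hsupp, hsmooth, hrange⟩ := hU.exists_contDiff_support_eq (n := ⊤)
  have hpos : ∀ k ∈ U, 0 < φ k := fun k hk =>
    lt_of_le_of_ne (hrange ⟨k, rfl⟩).1 (Ne.symm (by rwa [← hsupp] at hk))
  have hzero : ∀ k ∉ U, φ k = 0 := fun k hk => by
    rw [← hsupp] at hk
    exact Function.notMem_support.1 hk
  -- `1` once `m φ(k) ≥ 1`
  let η : ℕ → Mom d → ℂ := fun m k => ((Real.smoothTransition (m * φ k) : ℝ) : ℂ)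
  have hη0 : ∀ m, ∀ k ∉ U, η m k = 0 := fun m k hk => by
    simp [η, hzero k hk, Real.smoothTransition.zero]
  have hcpt : ∀ m, HasCompactSupport (η m) := fun m =>
    HasCompactSupport.intro hb.isCompact_closure fun k hk => hη0 m k fun h => hk (subset_closure h)
  have hsm : ∀ m, ContDiff ℝ ∞ (η m) := fun m =>
    ofRealCLM.contDiff.comp (Real.smoothTransition.contDiff.comp (contDiff_const.mul hsmooth))
  refine ⟨fun m => ⟨η m, hsm m, hcpt m, Set.subset_univ _⟩, fun m k => ?_, fun k => ?_⟩
  · change ‖η m k‖ ≤ _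
    by_cases hk : k ∈ U
    · rw [Set.indicator_of_mem hk, norm_real, Real.norm_of_nonneg (Real.smoothTransition.nonneg _)]
      exact Real.smoothTransition.le_one _
    · rw [Set.indicator_of_notMem hk, hη0 m k hk, norm_zero]
  · change Filter.Tendsto (fun m => η m k) _ _
    by_cases hk : k ∈ U
    · rw [Set.indicator_of_mem hk]
      refine tendsto_const_nhds.congr' ?_
      obtain ⟨N, hN⟩ := exists_nat_ge (1 / φ k)
      filter_upwards [Filter.eventually_ge_atTop N] with m hm
      have : 1 ≤ m * φ k := by
        rw [← div_le_iff₀ (hpos k hk)]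
        exact hN.trans (by exact_mod_cast hm)
      simp [η, Real.smoothTransition.one_of_one_le this]
    · rw [Set.indicator_of_notMem hk]
      exact tendsto_const_nhds.congr fun m => (hη0 m k hk).symm

section Products

variable {n : ℕ} {ψ : (Fin n → Mom d) → ℂ}

/-- Passing to the limit from products of smooth cutoffs to the indicator function of a box. -/
lemma setIntegral_box_eq_zero (hψ : MemLp ψ 2 volume)
    (h : ∀ f : Fin n → Test d, ∫ k, (∏ j, f j (k j)) * ψ k = 0)
    {U : Fin n → Set (Mom d)} (hU : ∀ j, IsOpen (U j)) (hb : ∀ j, Bornology.IsBounded (U j)) :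
    ∫ k in Set.univ.pi U, ψ k = 0 := by
  choose θ hθ1 hθ2 using fun j => exists_test_tendsto_indicator (hU j) (hb j)
  have hmeas : MeasurableSet (Set.univ.pi U) := MeasurableSet.univ_pi fun j => (hU j).measurableSet
  have hfin : volume (Set.univ.pi U) < ⊤ := (Bornology.IsBounded.pi hb).measure_lt_top
  have hint : IntegrableOn ψ (Set.univ.pi U) := by
    have : Fact (volume (Set.univ.pi U) < ⊤) := ⟨hfin⟩
    exact (hψ.restrict _).integrable one_le_two
  have hprod : ∀ k, ∏ j, (U j).indicator (fun _ => (1 : ℂ)) (k j) =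
      (Set.univ.pi U).indicator (fun _ => (1 : ℂ)) k := by
    intro k
    by_cases hk : k ∈ Set.univ.pi U
    · rw [Set.indicator_of_mem hk]
      exact Finset.prod_eq_one fun j _ => Set.indicator_of_mem (hk j (Set.mem_univ j)) _
    · rw [Set.indicator_of_notMem hk]
      simp only [Set.mem_pi, Set.mem_univ, true_implies, not_forall] at hk
      obtain ⟨j, hj⟩ := hk
      exact Finset.prod_eq_zero (Finset.mem_univ j) (Set.indicator_of_notMem hj _)
  have hlim := tendsto_integral_of_dominated_convergence
    (F := fun m k => (∏ j, θ j m (k j)) * ψ k)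
    (f := (Set.univ.pi U).indicator ψ) ((Set.univ.pi U).indicator fun k => ‖ψ k‖)
    (fun m => (continuous_prod_test fun j => θ j m).aestronglyMeasurable.mul hψ.1)
    ((integrable_indicator_iff hmeas).2 hint.norm)
    (fun m => .of_forall fun k => by
      rw [norm_mul, norm_prod]
      have h1 : ∏ j, ‖θ j m (k j)‖ ≤ ∏ j, (U j).indicator (fun _ => (1 : ℝ)) (k j) :=
        Finset.prod_le_prod (fun _ _ => norm_nonneg _) fun j _ => hθ1 j m (k j)
      by_cases hk : k ∈ Set.univ.pi U
      · rw [Set.indicator_of_mem hk]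
        refine mul_le_of_le_one_left (norm_nonneg _) (h1.trans (le_of_eq ?_))
        exact Finset.prod_eq_one fun j _ => Set.indicator_of_mem (hk j (Set.mem_univ j)) _
      · rw [Set.indicator_of_notMem hk]
        simp only [Set.mem_pi, Set.mem_univ, true_implies, not_forall] at hk
        obtain ⟨j, hj⟩ := hk
        have h2 : ∏ j, (U j).indicator (fun _ => (1 : ℝ)) (k j) = 0 :=
          Finset.prod_eq_zero (Finset.mem_univ j) (Set.indicator_of_notMem hj _)
        rw [h2] at h1
        exact mul_nonpos_of_nonpos_of_nonneg h1 (norm_nonneg _))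
    (.of_forall fun k => by
      have h1 := (tendsto_finsetProd Finset.univ fun j _ => hθ2 j (k j)).mul_const (ψ k)
      rw [hprod] at h1
      convert! h1 using 2
      by_cases hk : k ∈ Set.univ.pi U <;> simp [hk])
  simp_rw [h] at hlim
  rw [← integral_indicator hmeas]
  exact tendsto_nhds_unique hlim tendsto_const_nhds

/-- Products of test functions are total in `L²`: by monotone class arguments from open boxes. -/
lemma ae_eq_zero_of_forall_integral_prod (hψ : MemLp ψ 2 volume)
    (h : ∀ f : Fin n → Test d, ∫ k, (∏ j, f j (k j)) * ψ k = 0) : ψ =ᵐ[volume] 0 := by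
  let B : ℕ → Set (Fin n → Mom d) := fun N => Set.univ.pi fun _ => Metric.ball 0 N
  have hB : ∀ N, MeasurableSet (B N) := fun N =>
    MeasurableSet.univ_pi fun _ => Metric.isOpen_ball.measurableSet
  have hUnion : ⋃ N, B N = Set.univ := by
    refine Set.eq_univ_of_forall fun k => ?_
    obtain ⟨N, hN⟩ := exists_nat_gt (∑ j, ‖k j‖)
    refine Set.mem_iUnion.2 ⟨N, fun j _ => ?_⟩
    rw [mem_ball_zero_iff]
    exact (Finset.single_le_sum (f := fun j => ‖k j‖) (fun _ _ => norm_nonneg _)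
      (Finset.mem_univ j)).trans_lt hN
  have hN : ∀ N, ∀ᵐ k ∂volume.restrict (B N), ψ k = 0 := by
    intro N
    have hfin : volume (B N) < ⊤ :=
      (Bornology.IsBounded.pi fun _ => Metric.isBounded_ball).measure_lt_top
    have : Fact (volume (B N) < ⊤) := ⟨hfin⟩
    have hint : Integrable ψ (volume.restrict (B N)) := (hψ.restrict _).integrable one_le_two
    have hbox : ∀ U : Fin n → Set (Mom d), (∀ j, IsOpen (U j)) →
        ∫ k in Set.univ.pi U, ψ k ∂volume.restrict (B N) = 0 := by
      intro U hU
      rw [Measure.restrict_restrict (MeasurableSet.univ_pi fun j => (hU j).measurableSet),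
        ← Set.pi_inter_distrib]
      exact setIntegral_box_eq_zero hψ h (fun j => (hU j).inter Metric.isOpen_ball)
        fun j => Metric.isBounded_ball.subset Set.inter_subset_right
    have htot : ∫ k, ψ k ∂volume.restrict (B N) = 0 := by
      have := hbox (fun _ => Set.univ) fun _ => isOpen_univ
      rwa [Set.pi_univ, setIntegral_univ] at this
    refine hint.ae_eq_zero_of_forall_setIntegral_eq_zero fun s hs _ => ?_
    have hgen : (MeasurableSpace.pi : MeasurableSpace (Fin n → Mom d)) =
        MeasurableSpace.generateFrom (Set.univ.pi '' Set.univ.pi fun _ => {U | IsOpen U}) := by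
      refine (generateFrom_eq_pi (fun _ => ?_)
        fun _ => ⟨fun _ => Set.univ, fun _ => isOpen_univ, Set.iUnion_const _⟩).symm
      exact (BorelSpace.measurable_eq (α := Mom d)).symm
    induction s, hs using MeasurableSpace.induction_on_inter hgen
      (IsPiSystem.pi fun _ => isPiSystem_isOpen) with
    | empty => simp
    | basic t ht =>
      obtain ⟨U, hU, rfl⟩ := ht
      exact hbox U fun j => hU j (Set.mem_univ j)
    | compl t ht ih =>
      rw [setIntegral_compl ht hint, ih (measure_lt_top _ _), htot, sub_zero]
    | iUnion f hd hf ih =>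
      rw [integral_iUnion hf hd hint.integrableOn]
      simp [ih _ (measure_lt_top _ _)]
  have := (ae_restrict_iUnion_iff B fun k => ψ k = 0).2 hN
  rwa [hUnion, Measure.restrict_univ] at this

end Products

/-- The alternating sum over the sets containing `T` vanishes unless `T` is everything. -/
lemma sum_superset_neg_one_pow {n : ℕ} (T : Finset (Fin n)) (hT : T ≠ Finset.univ) :
    ∑ S : Finset (Fin n), (if T ⊆ S then (-1 : ℂ) ^ S.card else 0) = 0 := by
  obtain ⟨x, hx⟩ : ∃ x, x ∉ T := by
    by_contra! h
    exact hT (Finset.eq_univ_of_forall h)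
  refine Finset.sum_involution (fun S _ => symmDiff S {x}) ?_ ?_ (fun _ _ => Finset.mem_univ _) ?_
  · intro S _
    have h1 : T ⊆ symmDiff S {x} ↔ T ⊆ S := by
      refine forall₂_congr fun y hy => ?_
      have : y ≠ x := fun h => hx (h ▸ hy)
      simp [Finset.mem_symmDiff, this]
    simp only [h1]
    split_ifs
    · by_cases hxS : x ∈ S
      · have h2 : symmDiff S {x} = S.erase x := by
          ext y
          by_cases hy : y = x <;> simp [Finset.mem_symmDiff, hy, hxS]
        have h3 := Finset.card_erase_add_one hxS
        rw [h2, ← h3, pow_succ]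
        ring
      · have h2 : symmDiff S {x} = insert x S := by
          ext y
          by_cases hy : y = x <;> simp [Finset.mem_symmDiff, hy, hxS]
        rw [h2, Finset.card_insert_of_notMem hxS, pow_succ]
        ring
    · simp
  · intro S _ _ h
    have : symmDiff S {x} = S := h
    rw [symmDiff_eq_left] at this
    simp at this
  · intro S _
    exact symmDiff_symmDiff_cancel_right _ _

/-- Polarization: Ryser's formula for the permanent. -/
lemma sum_neg_one_pow_prod_sum {n : ℕ} (a : Fin n → Fin n → ℂ) :
    ∑ S : Finset (Fin n), (-1 : ℂ) ^ S.card * ∏ j, ∑ i ∈ S, a i j =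
      (-1) ^ n * ∑ σ : Equiv.Perm (Fin n), ∏ j, a (σ j) j := by
  have h1 : ∀ S : Finset (Fin n), (-1 : ℂ) ^ S.card * ∏ j, ∑ i ∈ S, a i j =
      ∑ p : Fin n → Fin n, (∏ j, a (p j) j) *
        (if Finset.univ.image p ⊆ S then (-1 : ℂ) ^ S.card else 0) := by
    intro S
    rw [Finset.prod_univ_sum, Finset.mul_sum]
    simp only [mul_ite, mul_zero]
    rw [← Finset.sum_filter]
    refine Finset.sum_congr ?_ fun _ _ => mul_comm _ _
    ext p
    simp [Finset.image_subset_iff]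
  simp_rw [h1]
  rw [Finset.sum_comm]
  simp_rw [← Finset.mul_sum]
  have h2 : ∀ p : Fin n → Fin n, ∑ S : Finset (Fin n),
      (if Finset.univ.image p ⊆ S then (-1 : ℂ) ^ S.card else 0) =
        if Function.Bijective p then (-1) ^ n else 0 := by
    intro p
    have hb : Function.Bijective p ↔ Finset.univ.image p = Finset.univ := by
      rw [← Finite.surjective_iff_bijective, ← Finset.coe_inj]
      simp [Set.range_eq_univ]
    split_ifs with hp
    · rw [hb.1 hp]
      simp [Finset.univ_subset_iff]
    · exact sum_superset_neg_one_pow _ fun h => hp (hb.2 h)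
  simp_rw [h2, mul_ite, mul_zero]
  rw [← Finset.sum_filter, Finset.mul_sum]
  refine (Finset.sum_bij (fun (σ : Equiv.Perm (Fin n)) _ => (σ : Fin n → Fin n)) ?_ ?_ ?_ ?_).symm
  · exact fun σ _ => Finset.mem_filter.2 ⟨Finset.mem_univ _, σ.bijective⟩
  · exact fun σ _ ρ _ h => DFunLike.coe_injective h
  · intro p hp
    exact ⟨Equiv.ofBijective p (Finset.mem_filter.1 hp).2, Finset.mem_univ _, rfl⟩
  · exact fun _ _ => mul_comm _ _

/-- A symmetric `L²` function orthogonal to all tensor powers `f^{⊗n}` vanishes: by polarization it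
is orthogonal to the symmetrizations of all products `f_1 ⊗ ⋯ ⊗ f_n`, and by its own symmetry to the
products themselves. -/
lemma symL2_eq_zero_of_inner_tensorPow {n : ℕ} (ψ : symL2 d n)
    (h : ∀ f : Test d, inner ℂ (tensorPow n f) ψ = 0) : ψ = 0 := by
  let φ : (Fin n → Mom d) → ℂ := (ψ : Lp ℂ 2 (volume : Measure (Fin n → Mom d)))
  have hφ : MemLp φ 2 volume := Lp.memLp _
  have hint : ∀ f : Fin n → Test d, Integrable fun k => (∏ j, f j (k j)) * φ k := fun f =>
    (memLp_prod_test f).integrable_mul hφ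
  have hpow : ∀ f : Test d, ∫ k, (∏ j, f (k j)) * φ k = 0 := by
    intro f
    rw [← h (conjTest f)]
    change _ = inner ℂ (prodL2 fun _ => conjTest f) (ψ : Lp ℂ 2 (volume : Measure (Fin n → Mom d)))
    rw [L2.inner_def]
    refine integral_congr_ae ?_
    filter_upwards [coeFn_prodL2 (n := n) fun _ => conjTest f] with k hk
    rw [hk, RCLike.inner_apply, map_prod, mul_comm]
    simp [φ]
  have hsymm : ∀ σ : Equiv.Perm (Fin n), (fun k => φ (k ∘ σ)) =ᵐ[volume] φ := by
    intro σ
    have h1 := Lp.coeFn_compMeasurePreserving (ψ : Lp ℂ 2 (volume : Measure (Fin n → Mom d)))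
      (perm_measurePreserving σ)
    rw [ψ.2 σ] at h1
    exact h1.symm
  have hperm : ∀ (g : Fin n → Test d) (σ : Equiv.Perm (Fin n)),
      ∫ k, (∏ j, g (σ j) (k j)) * φ k = ∫ k, (∏ j, g j (k j)) * φ k := by
    intro g σ
    have hmp := perm_measurePreserving (d := d) σ
    rw [← hmp.map_eq, integral_map hmp.aemeasurable]
    · rw [hmp.map_eq]
      refine integral_congr_ae ?_
      filter_upwards [hsymm σ] with k hk
      rw [hk]
      congr 1
      exact Equiv.prod_comp σ fun j => g j (k j)
    · rw [hmp.map_eq]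
      exact (hint _).1
  have hzero : ∀ g : Fin n → Test d, ∫ k, (∏ j, g j (k j)) * φ k = 0 := by
    intro g
    have h1 : ∑ S : Finset (Fin n), (-1 : ℂ) ^ S.card *
        ∫ k, (∏ j, (∑ i ∈ S, g i) (k j)) * φ k = 0 :=
      Finset.sum_eq_zero fun S _ => by rw [hpow, mul_zero]
    simp_rw [← integral_const_mul] at h1
    rw [← integral_finsetSum _ fun S _ => (hint fun _ => ∑ i ∈ S, g i).const_mul _] at h1
    have h2 : ∀ k : Fin n → Mom d, ∑ S : Finset (Fin n), (-1 : ℂ) ^ S.card *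
        ((∏ j, (∑ i ∈ S, g i) (k j)) * φ k) =
          (-1) ^ n * ∑ σ : Equiv.Perm (Fin n), (∏ j, g (σ j) (k j)) * φ k := by
      intro k
      have h3 : ∀ (S : Finset (Fin n)) (x : Mom d), (∑ i ∈ S, g i) x = ∑ i ∈ S, g i x := by
        intro S x
        induction S using Finset.cons_induction with
        | empty => rfl
        | cons i S hi ih =>
          rw [Finset.sum_cons, Finset.sum_cons, ← ih]
          rfl
      simp_rw [h3, ← mul_assoc]
      rw [← Finset.sum_mul, sum_neg_one_pow_prod_sum fun i j => g i (k j), mul_assoc,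
        Finset.sum_mul]
    simp_rw [h2] at h1
    rw [integral_const_mul, integral_finsetSum _ fun σ _ => hint fun j => g (σ j)] at h1
    simp_rw [hperm] at h1
    rw [Finset.sum_const, mul_eq_zero, smul_eq_zero] at h1
    rcases h1 with h1 | h1 | h1
    · exact absurd h1 (pow_ne_zero _ (by norm_num))
    · exact absurd h1 (Finset.card_ne_zero.2 ⟨1, Finset.mem_univ _⟩)
    · exact h1
  have h0 := ae_eq_zero_of_forall_integral_prod hφ hzero
  exact Subtype.ext (Lp.ext (h0.trans (Lp.coeFn_zero ℂ 2 _).symm))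

/-- A power series vanishing on the real line is zero. -/
lemma eq_zero_of_hasSum_pow {a : ℕ → ℂ} (h : ∀ r : ℝ, HasSum (fun n => r ^ n • a n) 0) (n : ℕ) :
    a n = 0 := by
  let p : FormalMultilinearSeries ℝ ℝ ℂ := fun n =>
    ContinuousMultilinearMap.mkPiRing ℝ (Fin n) (a n)
  have hp : ∀ n, p.coeff n = a n := fun n => by simp [p, FormalMultilinearSeries.coeff]
  have h1 : HasFPowerSeriesAt (0 : ℝ → ℂ) p 0 := by
    rw [hasFPowerSeriesAt_iff]
    refine .of_forall fun r => ?_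
    simp_rw [hp]
    exact h r
  rw [← hp, h1.eq_zero]
  rfl

/-- The coherent vectors are total: if `ψ` is orthogonal to the exponential vectors of all `r f`,
the power series `r ↦ ⟨expVec (r f), ψ⟩` vanishes, so each of its coefficients does. -/
lemma topologicalClosure_span_coherent :
    (Submodule.span ℂ (Set.range (coherent (d := d)))).topologicalClosure = ⊤ := by
  rw [Submodule.topologicalClosure_eq_top_iff, Submodule.eq_bot_iff]
  intro ψ hψ
  have hexp : ∀ f : Test d, inner ℂ (expVec f) ψ = 0 := by
    intro f
    have h1 := hψ (coherent f) (Submodule.subset_span ⟨f, rfl⟩)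
    rw [coherent, inner_smul_left, mul_eq_zero, conj_gauss] at h1
    exact h1.resolve_left (exp_ne_zero _)
  ext1
  funext n
  refine symL2_eq_zero_of_inner_tensorPow (ψ n) fun f => ?_
  have hpow : ∀ (r : ℝ) (m : ℕ), tensorPow m ((r : ℂ) • f) = ((r : ℂ) ^ m) • tensorPow m f := by
    intro r m
    refine Subtype.ext (Lp.ext ?_)
    change prodL2 (fun _ => (r : ℂ) • f) =ᵐ[volume]
      (((r : ℂ) ^ m) • prodL2 (fun _ => f) : Lp ℂ 2 (volume : Measure (Fin m → Mom d)))
    filter_upwards [coeFn_prodL2 (n := m) fun _ => (r : ℂ) • f, coeFn_prodL2 (n := m) fun _ => f,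
      Lp.coeFn_smul ((r : ℂ) ^ m) (prodL2 (n := m) fun _ => f)] with k h1 h2 h3
    rw [h1, h3, Pi.smul_apply, h2]
    change ∏ j, ((r : ℂ) * f (k j)) = _
    rw [Finset.prod_mul_distrib, Finset.prod_const, Finset.card_univ, Fintype.card_fin]
    rfl
  have hsum : ∀ r : ℝ, HasSum (fun m => r ^ m • ((expCoeff m : ℂ) * inner ℂ (tensorPow m f) (ψ m)))
      0 := by
    intro r
    have h1 := lp.hasSum_inner (𝕜 := ℂ) (expVec ((r : ℂ) • f)) ψ
    rw [hexp] at h1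
    convert! h1 using 2 with m
    rw [expVec_apply, inner_smul_left (𝕜 := ℂ) (tensorPow m ((r : ℂ) • f)) (ψ m), hpow, conj_ofReal,
      inner_smul_left (𝕜 := ℂ) (tensorPow m f) (ψ m), map_pow, conj_ofReal, real_smul]
    push_cast
    ring
  have h1 := eq_zero_of_hasSum_pow hsum n
  rw [mul_eq_zero] at h1
  refine h1.resolve_left ?_
  have : 0 < expCoeff n := by unfold expCoeff; positivity
  exact_mod_cast this.ne'

/-! ### The unitary group of the second quantized dispersion relation -/

namespace Dispersion

variable (ϖ : Dispersion d)

/-- The energy `ϖ(k_1) + ⋯ + ϖ(k_n)` of `n` particles. -/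
def energy (n : ℕ) (k : Fin n → Mom d) : ℝ := ∑ j, ϖ.toFun (k j)

/-- The function `e^{it(ϖ(k_1) + ⋯ + ϖ(k_n))}`. -/
def phaseN (n : ℕ) (t : ℝ) (k : Fin n → Mom d) : ℂ := exp (I * (t * ϖ.energy n k : ℝ))

lemma energy_nonneg (n : ℕ) (k : Fin n → Mom d) : 0 ≤ ϖ.energy n k :=
  Finset.sum_nonneg fun j _ => ϖ.mass_pos.le.trans (ϖ.mass_le (k j))

lemma continuous_energy (n : ℕ) : Continuous (ϖ.energy n) :=
  continuous_finsetSum _ fun j _ => ϖ.smooth.continuous.comp (continuous_apply j)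

lemma continuous_phaseN (n : ℕ) (t : ℝ) : Continuous (ϖ.phaseN n t) := by
  have := ϖ.continuous_energy n
  unfold phaseN
  fun_prop

lemma norm_phaseN (n : ℕ) (t : ℝ) (k : Fin n → Mom d) : ‖ϖ.phaseN n t k‖ = 1 := by
  rw [phaseN, mul_comm, norm_exp_ofReal_mul_I]

lemma phaseN_add (n : ℕ) (s t : ℝ) (k : Fin n → Mom d) :
    ϖ.phaseN n (s + t) k = ϖ.phaseN n s k * ϖ.phaseN n t k := by
  simp only [phaseN, ← Complex.exp_add]
  congr 1
  push_cast
  ring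

lemma phaseN_zero (n : ℕ) (k : Fin n → Mom d) : ϖ.phaseN n 0 k = 1 := by simp [phaseN]

lemma phaseN_eq_prod (n : ℕ) (t : ℝ) (k : Fin n → Mom d) :
    ϖ.phaseN n t k = ∏ j, ϖ.phase t (k j) := by
  simp only [phaseN, phase, energy, ← Complex.exp_sum]
  congr 1
  push_cast
  rw [Finset.mul_sum, Finset.mul_sum]

lemma phaseN_comp_perm (n : ℕ) (t : ℝ) (k : Fin n → Mom d) (σ : Equiv.Perm (Fin n)) :
    ϖ.phaseN n t (k ∘ σ) = ϖ.phaseN n t k := by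
  rw [phaseN_eq_prod, phaseN_eq_prod]
  exact Equiv.prod_comp σ fun j => ϖ.phase t (k j)

lemma hasDerivAt_phaseN (n : ℕ) (k : Fin n → Mom d) :
    HasDerivAt (fun t : ℝ => ϖ.phaseN n t k) (I * ϖ.energy n k) 0 := by
  have h1 : HasDerivAt (fun t : ℝ => I * ((t * ϖ.energy n k : ℝ) : ℂ)) (I * ϖ.energy n k) 0 := by
    have h2 := ((hasDerivAt_id (0 : ℝ)).mul_const (ϖ.energy n k)).ofReal_comp.const_mul I
    simpa using h2
  simpa [phaseN] using h1.cexp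

lemma norm_phaseN_sub_one_le (n : ℕ) (t : ℝ) (k : Fin n → Mom d) :
    ‖ϖ.phaseN n t k - 1‖ ≤ |t| * ϖ.energy n k := by
  have h := Real.norm_exp_I_mul_ofReal_sub_one_le (x := t * ϖ.energy n k)
  rwa [norm_mul, Real.norm_eq_abs, Real.norm_of_nonneg (ϖ.energy_nonneg n k)] at h

lemma memLp_phaseN_mul (n : ℕ) (t : ℝ) (ψ : Lp ℂ 2 (volume : Measure (Fin n → Mom d))) :
    MemLp (fun k => ϖ.phaseN n t k * ψ k) 2 volume :=
  (Lp.memLp ψ).of_le ((ϖ.continuous_phaseN n t).aestronglyMeasurable.mul (Lp.memLp ψ).1)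
    (.of_forall fun k => by rw [norm_mul, norm_phaseN, one_mul])

/-- The class of `e^{it(ϖ(k_1) + ⋯ + ϖ(k_n))} ψ`. -/
def mulPhase (n : ℕ) (t : ℝ) (ψ : Lp ℂ 2 (volume : Measure (Fin n → Mom d))) :
    Lp ℂ 2 (volume : Measure (Fin n → Mom d)) :=
  (ϖ.memLp_phaseN_mul n t ψ).toLp _

lemma coeFn_mulPhase (n : ℕ) (t : ℝ) (ψ : Lp ℂ 2 (volume : Measure (Fin n → Mom d))) :
    ϖ.mulPhase n t ψ =ᵐ[volume] fun k => ϖ.phaseN n t k * ψ k :=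
  (ϖ.memLp_phaseN_mul n t ψ).coeFn_toLp

lemma mulPhase_mem (n : ℕ) (t : ℝ) (ψ : symL2 d n) : ϖ.mulPhase n t ψ ∈ symL2 d n := by
  intro σ
  refine Lp.ext ?_
  have h1 := Lp.coeFn_compMeasurePreserving (ϖ.mulPhase n t ψ) (perm_measurePreserving σ)
  have h2 := Lp.coeFn_compMeasurePreserving (ψ : Lp ℂ 2 (volume : Measure (Fin n → Mom d)))
    (perm_measurePreserving σ)
  rw [ψ.2 σ] at h2
  have h3 := (perm_measurePreserving σ).quasiMeasurePreserving.ae (ϖ.coeFn_mulPhase n t ψ)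
  filter_upwards [h1, h2, h3, ϖ.coeFn_mulPhase n t ψ] with k h1 h2 h3 h4
  rw [h1, Function.comp_apply, h3, h4, phaseN_comp_perm, h2, Function.comp_apply]

lemma norm_mulPhase (n : ℕ) (t : ℝ) (ψ : Lp ℂ 2 (volume : Measure (Fin n → Mom d))) :
    ‖ϖ.mulPhase n t ψ‖ = ‖ψ‖ := by
  rw [mulPhase, Lp.norm_toLp, Lp.norm_def]
  congr 1
  exact eLpNorm_congr_norm_ae (.of_forall fun k => by rw [norm_mul, norm_phaseN, one_mul])

lemma mulPhase_add (n : ℕ) (t : ℝ) (ψ χ : Lp ℂ 2 (volume : Measure (Fin n → Mom d))) :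
    ϖ.mulPhase n t (ψ + χ) = ϖ.mulPhase n t ψ + ϖ.mulPhase n t χ := by
  refine Lp.ext ?_
  filter_upwards [ϖ.coeFn_mulPhase n t (ψ + χ), ϖ.coeFn_mulPhase n t ψ, ϖ.coeFn_mulPhase n t χ,
    Lp.coeFn_add ψ χ, Lp.coeFn_add (ϖ.mulPhase n t ψ) (ϖ.mulPhase n t χ)] with k h1 h2 h3 h4 h5
  rw [h1, h5, h4, Pi.add_apply, Pi.add_apply, h2, h3, mul_add]

lemma mulPhase_smul (n : ℕ) (t : ℝ) (c : ℂ) (ψ : Lp ℂ 2 (volume : Measure (Fin n → Mom d))) :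
    ϖ.mulPhase n t (c • ψ) = c • ϖ.mulPhase n t ψ := by
  refine Lp.ext ?_
  filter_upwards [ϖ.coeFn_mulPhase n t (c • ψ), ϖ.coeFn_mulPhase n t ψ, Lp.coeFn_smul c ψ,
    Lp.coeFn_smul c (ϖ.mulPhase n t ψ)] with k h1 h2 h3 h4
  rw [h1, h4, h3, Pi.smul_apply, Pi.smul_apply, h2, smul_eq_mul, smul_eq_mul, mul_left_comm]

lemma mulPhase_mulPhase (n : ℕ) (s t : ℝ) (ψ : Lp ℂ 2 (volume : Measure (Fin n → Mom d))) :
    ϖ.mulPhase n s (ϖ.mulPhase n t ψ) = ϖ.mulPhase n (s + t) ψ := by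
  refine Lp.ext ?_
  filter_upwards [ϖ.coeFn_mulPhase n s (ϖ.mulPhase n t ψ), ϖ.coeFn_mulPhase n t ψ,
    ϖ.coeFn_mulPhase n (s + t) ψ] with k h1 h2 h3
  rw [h1, h2, h3, phaseN_add, mul_assoc]

lemma mulPhase_zero (n : ℕ) (ψ : Lp ℂ 2 (volume : Measure (Fin n → Mom d))) :
    ϖ.mulPhase n 0 ψ = ψ := by
  refine Lp.ext ?_
  filter_upwards [ϖ.coeFn_mulPhase n 0 ψ] with k h1
  rw [h1, phaseN_zero, one_mul]

/-- The map on Fock space acting on the `n`-particle component by `mulPhase`. -/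
def fockPhase (t : ℝ) (ψ : Fock d) : Fock d :=
  ⟨fun n => ⟨ϖ.mulPhase n t (ψ n), ϖ.mulPhase_mem n t (ψ n)⟩, by
    refine memℓp_gen (((lp.memℓp ψ).summable (by norm_num)).congr fun n => ?_)
    congr 1
    exact (ϖ.norm_mulPhase n t (ψ n)).symm⟩

lemma fockPhase_fockPhase (s t : ℝ) (ψ : Fock d) :
    ϖ.fockPhase s (ϖ.fockPhase t ψ) = ϖ.fockPhase (s + t) ψ := by
  ext1
  funext n
  exact Subtype.ext (ϖ.mulPhase_mulPhase n s t (ψ n))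

lemma fockPhase_zero (ψ : Fock d) : ϖ.fockPhase 0 ψ = ψ := by
  ext1
  funext n
  exact Subtype.ext (ϖ.mulPhase_zero n (ψ n))

/-- The unitary operator `e^{it dΓ(ϖ)}` on Fock space. -/
def fockUnitary (t : ℝ) : Fock d ≃ₗᵢ[ℂ] Fock d where
  toFun := ϖ.fockPhase t
  invFun := ϖ.fockPhase (-t)
  left_inv ψ := by rw [fockPhase_fockPhase, neg_add_cancel, fockPhase_zero]
  right_inv ψ := by rw [fockPhase_fockPhase, add_neg_cancel, fockPhase_zero]
  map_add' ψ χ := by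
    ext1
    funext n
    exact Subtype.ext (ϖ.mulPhase_add n t (ψ n) (χ n))
  map_smul' c ψ := by
    ext1
    funext n
    exact Subtype.ext (ϖ.mulPhase_smul n t c (ψ n))
  norm_map' ψ := by
    change ‖ϖ.fockPhase t ψ‖ = ‖ψ‖
    rw [lp.norm_eq_tsum_rpow (by norm_num), lp.norm_eq_tsum_rpow (by norm_num)]
    congr 1
    refine tsum_congr fun n => ?_
    congr 1
    exact ϖ.norm_mulPhase n t (ψ n)

lemma coe_fockUnitary (t : ℝ) (ψ : Fock d) (n : ℕ) :
    (ϖ.fockUnitary t ψ n : Lp ℂ 2 (volume : Measure (Fin n → Mom d))) = ϖ.mulPhase n t (ψ n) := rfl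

lemma fockUnitary_coherent (t : ℝ) (f : Test d) :
    ϖ.fockUnitary t (coherent f) = coherent (ϖ.evolve t f) := by
  have hg : gauss (ϖ.evolve t f) = gauss f := by rw [gauss, testInner_evolve, gauss]
  rw [coherent, coherent, hg, map_smul]
  congr 1
  ext1
  funext n
  refine Subtype.ext ?_
  rw [coe_fockUnitary]
  change ϖ.mulPhase n t ((expCoeff n : ℂ) • prodL2 fun _ => f) =
    (expCoeff n : ℂ) • prodL2 fun _ => ϖ.evolve t f
  rw [mulPhase_smul]
  congr 1
  refine Lp.ext ?_
  filter_upwards [ϖ.coeFn_mulPhase n t (prodL2 fun _ => f), coeFn_prodL2 (n := n) fun _ => f,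
    coeFn_prodL2 (n := n) fun _ => ϖ.evolve t f] with k h1 h2 h3
  rw [h1, h2, h3, phaseN_eq_prod, ← Finset.prod_mul_distrib]
  rfl

end Dispersion

/-! ### Dominated convergence in Fock space and the generator -/

lemma norm_sq_symL2 {n : ℕ} (ψ : symL2 d n) {u : (Fin n → Mom d) → ℂ}
    (hu : (ψ : Lp ℂ 2 (volume : Measure (Fin n → Mom d))) =ᵐ[volume] u) :
    ‖ψ‖ ^ 2 = ∫ k, ‖u k‖ ^ 2 := by
  have h1 : (‖(ψ : Lp ℂ 2 (volume : Measure (Fin n → Mom d)))‖ ^ 2 : ℂ) =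
      ((∫ k, ‖u k‖ ^ 2 : ℝ) : ℂ) := by
    have h2 := inner_self_eq_norm_sq_to_K (𝕜 := ℂ)
      (ψ : Lp ℂ 2 (volume : Measure (Fin n → Mom d)))
    rw [L2.inner_def] at h2
    refine h2.symm.trans ?_
    rw [← integral_complex_ofReal]
    refine integral_congr_ae ?_
    filter_upwards [hu] with k hk
    rw [hk, inner_self_eq_norm_sq_to_K]
    push_cast
    rfl
  exact_mod_cast h1

/-- Dominated convergence in Fock space. -/
lemma tendsto_zero_of_dominated {l : Filter ℝ} [l.IsCountablyGenerated] {F : ℝ → Fock d}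
    (G : Fock d) (u : ∀ n, ℝ → (Fin n → Mom d) → ℂ)
    (hF : ∀ n t, (F t n : Lp ℂ 2 (volume : Measure (Fin n → Mom d))) =ᵐ[volume] u n t)
    (hG : ∀ᶠ t in l, ∀ n, ∀ᵐ k, ‖u n t k‖ ≤
      ‖(G n : Lp ℂ 2 (volume : Measure (Fin n → Mom d))) k‖)
    (hlim : ∀ n k, Filter.Tendsto (fun t => u n t k) l (nhds 0)) :
    Filter.Tendsto F l (nhds 0) := by
  have hsq : ∀ ψ : Fock d, ‖ψ‖ ^ 2 = ∑' n, ‖ψ n‖ ^ 2 := by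
    intro ψ
    have := lp.norm_rpow_eq_tsum (p := 2) (by norm_num) ψ
    simpa using this
  have hGint : ∀ n, Integrable fun k =>
      ‖(G n : Lp ℂ 2 (volume : Measure (Fin n → Mom d))) k‖ ^ 2 := fun n =>
    (Lp.memLp (G n : Lp ℂ 2 (volume : Measure (Fin n → Mom d)))).norm.integrable_sq
  have hmeas : ∀ n t, AEStronglyMeasurable (u n t) volume := fun n t =>
    (Lp.memLp (F t n : Lp ℂ 2 (volume : Measure (Fin n → Mom d)))).1.congr (hF n t)
  have hcomp : ∀ n, Filter.Tendsto (fun t => ‖F t n‖ ^ 2) l (nhds 0) := by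
    intro n
    simp_rw [fun t => norm_sq_symL2 (F t n) (hF n t)]
    have h := tendsto_integral_filter_of_dominated_convergence (μ := volume) (l := l)
      (F := fun t k => ‖u n t k‖ ^ 2) (f := fun _ => (0 : ℝ))
      (fun k => ‖(G n : Lp ℂ 2 (volume : Measure (Fin n → Mom d))) k‖ ^ 2)
      (.of_forall fun t => ((hmeas n t).norm.pow 2))
      (by
        filter_upwards [hG] with t ht
        filter_upwards [ht n] with k hk
        rw [norm_pow, norm_norm]
        gcongr)
      (hGint n)
      (.of_forall fun k => by
        have := (hlim n k).norm.pow 2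
        simpa using this)
    simpa using h
  have htot : Filter.Tendsto (fun t => ‖F t‖ ^ 2) l (nhds 0) := by
    simp_rw [hsq]
    have hsum : Summable fun n => ‖G n‖ ^ 2 := by
      have := (lp.memℓp G).summable (by norm_num)
      simpa using this
    have h := tendsto_tsum_of_dominated_convergence (𝓕 := l) (f := fun t n => ‖F t n‖ ^ 2)
      (g := fun _ => (0 : ℝ)) hsum hcomp (by
        filter_upwards [hG] with t ht n
        rw [norm_pow, norm_norm, norm_sq_symL2 (F t n) (hF n t),
          norm_sq_symL2 (G n) Filter.EventuallyEq.rfl]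
        refine integral_mono_of_nonneg (.of_forall fun k => sq_nonneg _) (hGint n) ?_
        filter_upwards [ht n] with k hk
        gcongr)
    simpa using h
  rw [tendsto_zero_iff_norm_tendsto_zero]
  have := htot.sqrt
  simpa using this

namespace Dispersion

variable (ϖ : Dispersion d)

lemma continuous_fockUnitary (ψ : Fock d) : Continuous fun t => ϖ.fockUnitary t ψ := by
  refine continuous_iff_continuousAt.2 fun s => ?_
  refine tendsto_sub_nhds_zero_iff.1 ?_
  refine tendsto_zero_of_dominated ((2 : ℂ) • ψ)
    (fun n t k => (ϖ.phaseN n t k - ϖ.phaseN n s k) *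
      (ψ n : Lp ℂ 2 (volume : Measure (Fin n → Mom d))) k) (fun n t => ?_)
    (.of_forall fun t n => ?_) fun n k => ?_
  · filter_upwards [ϖ.coeFn_mulPhase n t (ψ n), ϖ.coeFn_mulPhase n s (ψ n),
      Lp.coeFn_sub (ϖ.mulPhase n t (ψ n)) (ϖ.mulPhase n s (ψ n))] with k h1 h2 h3
    change (ϖ.mulPhase n t (ψ n) - ϖ.mulPhase n s (ψ n) :
      Lp ℂ 2 (volume : Measure (Fin n → Mom d))) k = _
    rw [h3, Pi.sub_apply, h1, h2, sub_mul]
  · filter_upwards [Lp.coeFn_smul (2 : ℂ) (ψ n : Lp ℂ 2 (volume : Measure (Fin n → Mom d)))]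
      with k h1
    change _ ≤ ‖((2 : ℂ) • (ψ n : Lp ℂ 2 (volume : Measure (Fin n → Mom d))) :
      Lp ℂ 2 (volume : Measure (Fin n → Mom d))) k‖
    rw [h1, Pi.smul_apply, norm_mul, norm_smul]
    refine mul_le_mul_of_nonneg_right ((norm_sub_le _ _).trans ?_) (norm_nonneg _)
    rw [norm_phaseN, norm_phaseN]
    norm_num
  · have h1 : Continuous fun t => (ϖ.phaseN n t k - ϖ.phaseN n s k) *
        (ψ n : Lp ℂ 2 (volume : Measure (Fin n → Mom d))) k := by
      unfold phaseN
      fun_prop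
    simpa using h1.tendsto s

lemma slope_fockUnitary_coeFn (ψ : Fock d) (n : ℕ) (t : ℝ) :
    (slope (fun t => ϖ.fockUnitary t ψ) 0 t n : Lp ℂ 2 (volume : Measure (Fin n → Mom d)))
      =ᵐ[volume] fun k => slope (fun t => ϖ.phaseN n t k) 0 t *
        (ψ n : Lp ℂ 2 (volume : Measure (Fin n → Mom d))) k := by
  filter_upwards [ϖ.coeFn_mulPhase n t (ψ n), ϖ.coeFn_mulPhase n 0 (ψ n),
    Lp.coeFn_sub (ϖ.mulPhase n t (ψ n)) (ϖ.mulPhase n 0 (ψ n)),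
    Lp.coeFn_smul (t - 0)⁻¹ (ϖ.mulPhase n t (ψ n) - ϖ.mulPhase n 0 (ψ n))] with k h1 h2 h3 h4
  change ((t - 0)⁻¹ • (ϖ.mulPhase n t (ψ n) - ϖ.mulPhase n 0 (ψ n)) :
      Lp ℂ 2 (volume : Measure (Fin n → Mom d))) k = _
  rw [h4, Pi.smul_apply, h3, Pi.sub_apply, h1, h2, slope_def_module, ← sub_mul, smul_mul_assoc]

lemma tendsto_slope_phaseN (n : ℕ) (k : Fin n → Mom d) :
    Filter.Tendsto (fun t => slope (fun t => ϖ.phaseN n t k) 0 t) (nhdsWithin 0 {0}ᶜ)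
      (nhds (I * ϖ.energy n k)) :=
  hasDerivAt_iff_tendsto_slope.1 (ϖ.hasDerivAt_phaseN n k)

lemma norm_slope_phaseN_le (n : ℕ) (k : Fin n → Mom d) {t : ℝ} (ht : t ≠ 0) :
    ‖slope (fun t => ϖ.phaseN n t k) 0 t‖ ≤ ϖ.energy n k := by
  rw [slope_def_module, norm_smul, phaseN_zero, sub_zero, norm_inv, Real.norm_eq_abs,
    inv_mul_le_iff₀ (abs_pos.2 ht)]
  exact ϖ.norm_phaseN_sub_one_le n t k

/-- On the domain of `dΓ(ϖ)` the unitary group is differentiable: difference quotients of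
`e^{itE}` are bounded by `E`. -/
lemma hasDerivAt_fockUnitary {ψ χ : Fock d} (h : (ψ, χ) ∈ secondQuantGraph ϖ) :
    HasDerivAt (fun t : ℝ => ϖ.fockUnitary t ψ) (I • χ) 0 := by
  rw [hasDerivAt_iff_tendsto_slope]
  refine tendsto_sub_nhds_zero_iff.1 ?_
  refine tendsto_zero_of_dominated ((2 : ℂ) • χ)
    (fun n t k => (slope (fun t => ϖ.phaseN n t k) 0 t - I * ϖ.energy n k) *
      (ψ n : Lp ℂ 2 (volume : Measure (Fin n → Mom d))) k) (fun n t => ?_) ?_ fun n k => ?_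
  · filter_upwards [ϖ.slope_fockUnitary_coeFn ψ n t, h n,
      Lp.coeFn_smul I (χ n : Lp ℂ 2 (volume : Measure (Fin n → Mom d))),
      Lp.coeFn_sub (slope (fun t => ϖ.fockUnitary t ψ) 0 t n :
        Lp ℂ 2 (volume : Measure (Fin n → Mom d)))
        (I • (χ n : Lp ℂ 2 (volume : Measure (Fin n → Mom d))))] with k h1 h2 h3 h4
    change ((slope (fun t => ϖ.fockUnitary t ψ) 0 t n :
        Lp ℂ 2 (volume : Measure (Fin n → Mom d))) -
        (I • (χ n : Lp ℂ 2 (volume : Measure (Fin n → Mom d)))) :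
        Lp ℂ 2 (volume : Measure (Fin n → Mom d))) k = _
    rw [h4, Pi.sub_apply, h3, h1, Pi.smul_apply, h2, smul_eq_mul, energy]
    ring
  · filter_upwards [self_mem_nhdsWithin] with t ht n
    filter_upwards [h n, Lp.coeFn_smul (2 : ℂ) (χ n : Lp ℂ 2 (volume : Measure (Fin n → Mom d)))]
      with k h1 h2
    change _ ≤ ‖((2 : ℂ) • (χ n : Lp ℂ 2 (volume : Measure (Fin n → Mom d))) :
      Lp ℂ 2 (volume : Measure (Fin n → Mom d))) k‖
    rw [h2, Pi.smul_apply, h1, norm_mul, norm_smul, norm_mul, ← mul_assoc]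
    refine mul_le_mul_of_nonneg_right ((norm_sub_le _ _).trans ?_) (norm_nonneg _)
    have h3 := ϖ.norm_slope_phaseN_le n k ht
    rw [norm_mul, norm_I, one_mul, norm_real, norm_real,
      Real.norm_of_nonneg (ϖ.energy_nonneg n k)]
    have h4 : ‖∑ j, ϖ.toFun (k j)‖ = ϖ.energy n k := Real.norm_of_nonneg (ϖ.energy_nonneg n k)
    rw [h4]
    norm_num
    linarith
  · have := ((ϖ.tendsto_slope_phaseN n k).sub_const (I * ϖ.energy n k)).mul_const
      ((ψ n : Lp ℂ 2 (volume : Measure (Fin n → Mom d))) k)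
    simpa using this

/-- Conversely, where the unitary group is differentiable, a sequence of difference quotients
converges almost everywhere, which identifies the derivative as multiplication by the energy. -/
lemma mem_secondQuantGraph_of_hasDerivAt {ψ χ : Fock d}
    (h : HasDerivAt (fun t : ℝ => ϖ.fockUnitary t ψ) (I • χ) 0) :
    (ψ, χ) ∈ secondQuantGraph ϖ := by
  intro n
  change (χ n : Lp ℂ 2 (volume : Measure (Fin n → Mom d))) =ᵐ[volume] fun k =>
    (ϖ.energy n k : ℂ) * (ψ n : Lp ℂ 2 (volume : Measure (Fin n → Mom d))) k
  rw [hasDerivAt_iff_tendsto_slope] at h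
  let s : ℕ → ℝ := fun m => 1 / ((m : ℝ) + 1)
  have hs : Filter.Tendsto s Filter.atTop (nhdsWithin 0 {0}ᶜ) :=
    tendsto_nhdsWithin_iff.2 ⟨tendsto_one_div_add_atTop_nhds_zero_nat,
      .of_forall fun m => (by positivity : (0 : ℝ) < 1 / ((m : ℝ) + 1)).ne'⟩
  have h1 := h.comp hs
  have h2 : Filter.Tendsto (fun m => (slope (fun t => ϖ.fockUnitary t ψ) 0 (s m) n :
      Lp ℂ 2 (volume : Measure (Fin n → Mom d)))) Filter.atTop
      (nhds (I • (χ n : Lp ℂ 2 (volume : Measure (Fin n → Mom d))))) :=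
    (continuous_subtype_val.comp
      (lp.evalCLM ℂ (fun n : ℕ => symL2 d n) (p := 2) n).continuous).continuousAt.tendsto.comp h1
  obtain ⟨ns, hns, hae⟩ := (tendstoInMeasure_of_tendsto_Lp h2).exists_seq_tendsto_ae
  have h3 : ∀ᵐ k ∂(volume : Measure (Fin n → Mom d)), ∀ m,
      (slope (fun t => ϖ.fockUnitary t ψ) 0 (s m) n :
        Lp ℂ 2 (volume : Measure (Fin n → Mom d))) k =
      slope (fun t => ϖ.phaseN n t k) 0 (s m) *
        (ψ n : Lp ℂ 2 (volume : Measure (Fin n → Mom d))) k :=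
    ae_all_iff.2 fun m => ϖ.slope_fockUnitary_coeFn ψ n (s m)
  filter_upwards [hae, h3,
    Lp.coeFn_smul I (χ n : Lp ℂ 2 (volume : Measure (Fin n → Mom d)))] with k h4 h5 h6
  rw [h6] at h4
  simp_rw [h5] at h4
  have h7 := (((ϖ.tendsto_slope_phaseN n k).comp hs).comp hns.tendsto_atTop).mul_const
    ((ψ n : Lp ℂ 2 (volume : Measure (Fin n → Mom d))) k)
  have h8 := tendsto_nhds_unique h4 h7
  rw [Pi.smul_apply, smul_eq_mul, mul_assoc] at h8
  exact mul_left_cancel₀ I_ne_zero h8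

/-- The generator of the unitary group is `dΓ(ϖ)`, including its maximal domain. -/
theorem isUnitaryGroupOf_fockUnitary :
    IsUnitaryGroupOf (secondQuant ϖ) ϖ.fockUnitary where
  map_zero := ϖ.fockPhase_zero
  map_add s t ψ := (ϖ.fockPhase_fockPhase s t ψ).symm
  continuous := ϖ.continuous_fockUnitary
  generator ψ χ := by
    rw [secondQuant_graph]
    exact ⟨ϖ.hasDerivAt_fockUnitary, ϖ.mem_secondQuantGraph_of_hasDerivAt⟩

end Dispersion

/-! ### Representations on coherent families -/

/-- A total family of vectors in a Hilbert space whose Gram matrix is invariant under the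
translations `e(g) ↦ e^{-iπ² Im⟨f,g⟩} e(f + g)`. -/
structure IsCoherentFamily {H : Type*} [NormedAddCommGroup H] [InnerProductSpace ℂ H]
    (e : Test d → H) : Prop where
  total : (Submodule.span ℂ (Set.range e)).topologicalClosure = ⊤
  gram : ∀ f g h, inner ℂ (weylPhase f g • e (f + g)) (weylPhase f h • e (f + h)) =
    inner ℂ (e g) (e h)

lemma weylPhase_ne_zero (f g : Test d) : weylPhase f g ≠ 0 := exp_ne_zero _

namespace IsCoherentFamily

variable {H : Type*} [NormedAddCommGroup H] [InnerProductSpace ℂ H] {e : Test d → H}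

lemma clm_ext (he : IsCoherentFamily e) {A B : H →L[ℂ] H} (h : ∀ f, A (e f) = B (e f)) :
    A = B := by
  refine ContinuousLinearMap.ext_on (s := Set.range e) ?_ ?_
  · exact Submodule.dense_iff_topologicalClosure_eq_top.2 he.total
  · rintro _ ⟨f, rfl⟩
    exact h f

variable [CompleteSpace H]

/-- The Weyl operators determined by `W(f) e(g) = e^{-iπ² Im⟨f,g⟩} e(f + g)`. -/
lemma exists_weylSystem (he : IsCoherentFamily e) : ∃ w : Test d → (H →L[ℂ] H), IsWeylSystem w ∧
    ∀ f g, w f (e g) = weylPhase f g • e (f + g) := by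
  have htot : ∀ f : Test d, (Submodule.span ℂ
      (Set.range fun g => weylPhase f g • e (f + g))).topologicalClosure = ⊤ := by
    intro f
    refine top_unique (he.total.symm.le.trans
      (Submodule.topologicalClosure_mono (Submodule.span_le.2 ?_)))
    rintro _ ⟨h, rfl⟩
    have h1 : e h = (weylPhase f (h - f))⁻¹ • (weylPhase f (h - f) • e (f + (h - f))) := by
      rw [inv_smul_smul₀ (weylPhase_ne_zero _ _), add_sub_cancel]
    rw [h1]
    exact Submodule.smul_mem _ _ (Submodule.subset_span ⟨h - f, rfl⟩)
  choose U hU using fun f : Test d => exists_unitary_of_gram_eq e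
    (fun g => weylPhase f g • e (f + g)) he.total (htot f) fun g h => (he.gram f g h).symm
  let w : Test d → (H →L[ℂ] H) := fun f => (U f).toLinearIsometry.toContinuousLinearMap
  have hw : ∀ f g, w f (e g) = weylPhase f g • e (f + g) := hU
  have hmul : ∀ f g, w f * w g = weylPhase f g • w (f + g) := by
    intro f g
    refine he.clm_ext fun h => ?_
    change w f (w g (e h)) = weylPhase f g • w (f + g) (e h)
    rw [hw, map_smul, hw, hw, smul_smul, smul_smul, ← add_assoc]
    congr 1
    simp only [weylPhase, ← Complex.exp_add, symp_add_left, symp_add_right]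
    congr 1
    push_cast
    ring
  have hzero : w 0 = 1 := he.clm_ext fun h => by
    rw [hw, weylPhase_zero_left, zero_add, one_smul]
    rfl
  refine ⟨w, ⟨hzero, hmul, fun f => ?_⟩, hw⟩
  -- `w f` is unitary with inverse `w (-f)`
  have h1 : star (w f) * w f = 1 := (U f).toLinearIsometry.adjoint_comp_self
  have h2 : w f * w (-f) = 1 := by
    rw [hmul, weylPhase_neg_self, add_neg_cancel, hzero, one_smul]
  exact left_inv_eq_right_inv h1 h2

/-- The representation of the Weyl algebra on a coherent family, shifted by a character. -/
lemma exists_rep (he : IsCoherentFamily e) (T : Test d →ₗ[ℂ] ℂ) :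
    ∃ π : WeylAlgebra d →⋆ₐ[ℂ] (H →L[ℂ] H),
      ∀ f g, π (weyl f) (e g) = weylChar T f • weylPhase f g • e (f + g) := by
  obtain ⟨w, hw, hcoh⟩ := he.exists_weylSystem
  obtain ⟨π, hπ⟩ := IsWeylSystem.exists_starAlgHom (B := H →L[ℂ] H)
    (hw.twist T LinearMap.id fun _ _ => rfl)
  refine ⟨π, fun f g => ?_⟩
  rw [hπ]
  change weylChar T f • w f (e g) = _
  rw [hcoh]

lemma dense_range_rep (he : IsCoherentFamily e) {T : Test d →ₗ[ℂ] ℂ}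
    {π : WeylAlgebra d →⋆ₐ[ℂ] (H →L[ℂ] H)}
    (hπ : ∀ f g, π (weyl f) (e g) = weylChar T f • weylPhase f g • e (f + g)) :
    Dense (Set.range fun a => π a (e 0)) := by
  let L : WeylAlgebra d →ₗ[ℂ] H :=
    { toFun := fun a => π a (e 0)
      map_add' := fun a b => by rw [map_add]; rfl
      map_smul' := fun c a => by rw [map_smul]; rfl }
  have h : (LinearMap.range L).topologicalClosure = ⊤ := by
    refine top_unique (he.total.symm.le.trans
      (Submodule.topologicalClosure_mono (Submodule.span_le.2 ?_)))
    rintro _ ⟨f, rfl⟩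
    refine ⟨(weylChar T f)⁻¹ • weyl f, ?_⟩
    rw [map_smul]
    change _ • π (weyl f) (e 0) = _
    rw [hπ, inv_smul_smul₀ (weylChar_ne_zero T f), weylPhase_zero_right, one_smul, add_zero]
  exact Submodule.dense_iff_topologicalClosure_eq_top.2 h

/-- If a one-parameter unitary group moves a coherent family by `e^{itϖ}`, then it implements the
van Hove dynamics: on Weyl operators the drift character exactly compensates the change of the
character of `-v/ϖ`. -/
lemma rep_dynamics (he : IsCoherentFamily e) {ϖ : Dispersion d} {v : Dist d}
    {τ : ℝ → WeylAlgebra d ≃⋆ₐ[ℂ] WeylAlgebra d} (hτ : IsVanHoveDynamics ϖ v τ)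
    {π : WeylAlgebra d →⋆ₐ[ℂ] (H →L[ℂ] H)}
    (hπ : ∀ f g, π (weyl f) (e g) =
      weylChar (-ϖ.divSource v) f • weylPhase f g • e (f + g))
    {U : ℝ → H ≃ₗᵢ[ℂ] H} (hU : ∀ t f, U t (e f) = e (ϖ.evolve t f))
    (t : ℝ) (a : WeylAlgebra d) (ψ : H) :
    π (τ t a) ψ = U t (π a (U (-t) ψ)) := by
  let V : ℝ → (H →L[ℂ] H) := fun t => (U t).toLinearIsometry.toContinuousLinearMap
  let F : WeylAlgebra d →ₗ[ℂ] (H →L[ℂ] H) :=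
    (π.comp (τ t : WeylAlgebra d →⋆ₐ[ℂ] WeylAlgebra d)).toAlgHom.toLinearMap
  let G : WeylAlgebra d →ₗ[ℂ] (H →L[ℂ] H) :=
    { toFun := fun a => V t * π a * V (-t)
      map_add' := fun a b => by rw [map_add, mul_add, add_mul]
      map_smul' := fun c a => by
        rw [map_smul, mul_smul_comm, smul_mul_assoc]
        rfl }
  have hcont : Continuous π := continuous_starAlgHom (B := H →L[ℂ] H) π
  have hF : Continuous F := hcont.comp (hτ.isometry t).continuous
  have hG : Continuous G := (continuous_const.mul hcont).mul continuous_const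
  have h : F a = G a := by
    refine eq_of_eq_on_weyl F G hF hG (fun f => he.clm_ext fun g => ?_) a
    change π (τ t (weyl f)) (e g) = U t (π (weyl f) (U (-t) (e g)))
    have hdrift : weylChar (ϖ.driftSource v t) f * weylChar (-ϖ.divSource v) (ϖ.evolve t f) =
        weylChar (-ϖ.divSource v) f := by
      have hneg : ∀ (f : Test d) (T : Test d →ₗ[ℂ] ℂ), bracket f (-T) = -bracket f T :=
        fun _ _ => rfl
      simp only [weylChar, hneg, ϖ.bracket_driftSource, ← Complex.exp_add, sub_re, neg_re,
        ofReal_sub, ofReal_neg]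
      congr 1
      ring
    have hinv : ϖ.evolve t (ϖ.evolve (-t) g) = g := by
      rw [← ϖ.evolve_add, add_neg_cancel, ϖ.evolve_zero]
    have hphase : weylPhase f (ϖ.evolve (-t) g) = weylPhase (ϖ.evolve t f) g := by
      rw [weylPhase, weylPhase, ← ϖ.symp_evolve t f, hinv]
    have hleft : π (τ t (weyl f)) (e g) = weylChar (ϖ.driftSource v t) f •
        π (weyl (ϖ.evolve t f)) (e g) := by
      rw [hτ.map_weyl, map_smul]
      rfl
    rw [hleft, hπ, hU, hπ, map_smul, map_smul, hU, map_add, hinv, hphase, smul_smul, hdrift]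
  exact congrArg (fun A : H →L[ℂ] H => A ψ) h

end IsCoherentFamily

/-! ### Vector states and their GNS representations -/

section VectorState

variable {H : Type*} [NormedAddCommGroup H] [InnerProductSpace ℂ H] [CompleteSpace H]
  (π : WeylAlgebra d →⋆ₐ[ℂ] (H →L[ℂ] H)) (Ω : H)

/-- The linear functional `a ↦ ⟨Ω, π(a) Ω⟩`. -/
def vectorFunctional : WeylAlgebra d →ₗ[ℂ] ℂ where
  toFun a := inner ℂ Ω (π a Ω)
  map_add' a b := by
    rw [map_add, _root_.add_apply, inner_add_right]
  map_smul' c a := by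
    rw [map_smul, _root_.smul_apply, inner_smul_right]
    rfl

lemma vectorFunctional_apply (a : WeylAlgebra d) :
    vectorFunctional π Ω a = inner ℂ Ω (π a Ω) := rfl

lemma continuous_vectorFunctional : Continuous (vectorFunctional π Ω) := by
  have h : Continuous π := continuous_starAlgHom (B := H →L[ℂ] H) π
  change Continuous fun a => inner ℂ Ω (π a Ω)
  fun_prop

lemma vectorFunctional_star_mul (a b : WeylAlgebra d) :
    vectorFunctional π Ω (star a * b) = inner ℂ (π a Ω) (π b Ω) := by
  have h : π (star a * b) = star (π a) * π b := by rw [map_mul π, map_star π]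
  rw [vectorFunctional_apply, h]
  exact ContinuousLinearMap.adjoint_inner_right (π a) Ω (π b Ω)

lemma vectorFunctional_nonneg {a : WeylAlgebra d} (ha : 0 ≤ a) : 0 ≤ vectorFunctional π Ω a := by
  obtain ⟨b, rfl⟩ := CStarAlgebra.nonneg_iff_eq_star_mul_self.1 ha
  rw [vectorFunctional_star_mul, inner_self_eq_norm_sq_to_K (𝕜 := ℂ)]
  exact pow_nonneg (RCLike.ofReal_nonneg.2 (norm_nonneg _)) 2

lemma _root_.DenseRange.topologicalClosure_span {ι E : Type*} [NormedAddCommGroup E]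
    [NormedSpace ℂ E] {y : ι → E} (hy : DenseRange y) :
    (Submodule.span ℂ (Set.range y)).topologicalClosure = ⊤ :=
  Submodule.dense_iff_topologicalClosure_eq_top.1 (hy.mono Submodule.subset_span)

/-- By uniqueness of the GNS representation, a representation with a cyclic vector realizes the GNS
representation of its vector functional. -/
lemma exists_gns_unitary (ρ : WeylAlgebra d →ₚ[ℂ] ℂ) (hρ : ∀ a, ρ a = vectorFunctional π Ω a)
    (hcyc : DenseRange fun a => π a Ω) :
    ∃ U : ρ.GNS ≃ₗᵢ[ℂ] H,
      (∀ a ξ, U (ρ.gnsStarAlgHom a ξ) = π a (U ξ)) ∧ U (gnsVector ρ) = Ω := by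
  let x : ρ.PreGNS → ρ.GNS := fun a => (a : ρ.GNS)
  have hdense : DenseRange x := UniformSpace.Completion.denseRange_coe
  have hdense' : DenseRange ((fun a => π a Ω) ∘ ρ.ofPreGNS) := by
    rw [DenseRange, ρ.ofPreGNS.surjective.range_comp]
    exact hcyc
  obtain ⟨U, hU⟩ := exists_unitary_of_gram_eq x (fun a => π (ρ.ofPreGNS a) Ω)
    hdense.topologicalClosure_span hdense'.topologicalClosure_span fun a b => by
      rw [UniformSpace.Completion.inner_coe, PositiveLinearMap.preGNS_inner_def, hρ,
        ← vectorFunctional_star_mul]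
  refine ⟨U, fun a ξ => ?_, ?_⟩
  · have hcl : IsClosed {ξ | U (ρ.gnsStarAlgHom a ξ) = π a (U ξ)} :=
      isClosed_eq (U.continuous.comp (ρ.gnsStarAlgHom a).continuous)
        ((π a).continuous.comp U.continuous)
    refine hdense.induction_on (p := fun ξ => U (ρ.gnsStarAlgHom a ξ) = π a (U ξ)) ξ hcl fun b => ?_
    have h1 : ρ.gnsStarAlgHom a (x b) = x (ρ.toPreGNS (a * ρ.ofPreGNS b)) :=
      PositiveLinearMap.gnsNonUnitalStarAlgHom_apply_coe ρ
    rw [h1, hU, hU, PositiveLinearMap.ofPreGNS_toPreGNS, map_mul]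
    rfl
  · have := hU (ρ.toPreGNS 1)
    rw [PositiveLinearMap.ofPreGNS_toPreGNS, map_one π] at this
    exact this

end VectorState

/-! ### The coherent state -/

lemma isCoherentFamily_coherent : IsCoherentFamily (coherent (d := d)) :=
  ⟨topologicalClosure_span_coherent, inner_coherent_add⟩

lemma vectorFunctional_vacuum_weyl {T : Test d →ₗ[ℂ] ℂ}
    {π : WeylAlgebra d →⋆ₐ[ℂ] (Fock d →L[ℂ] Fock d)}
    (hπ : ∀ f g, π (weyl f) (coherent g) = weylChar T f • weylPhase f g • coherent (f + g))
    (f : Test d) : vectorFunctional π (vacuum d) (weyl f) =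
      exp (-(Real.pi ^ 2 / 2) * testInner f f) * weylChar T f := by
  rw [vectorFunctional_apply, ← coherent_zero, hπ, weylPhase_zero_right, one_smul, add_zero,
    inner_smul_right, inner_coherent, testInner_zero_left, testInner_zero_left, zero_add, mul_zero,
    add_zero, mul_comm]

lemma testInner_ofReal_smul (r : ℝ) (f : Test d) :
    testInner ((r : ℂ) • f) ((r : ℂ) • f) = (r : ℂ) ^ 2 * testInner f f := by
  unfold testInner
  rw [← integral_const_mul]
  congr 1
  ext k
  change (starRingEnd ℂ) ((r : ℂ) * f k) * ((r : ℂ) * f k) = _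
  rw [map_mul, conj_ofReal]
  ring

lemma bracket_ofReal_smul (r : ℝ) (f : Test d) (T : Test d →ₗ[ℂ] ℂ) :
    bracket ((r : ℂ) • f) T = (r : ℂ) * bracket f T := by
  have h : conjTest ((r : ℂ) • f) = (r : ℂ) • conjTest f := by
    ext k
    change (starRingEnd ℂ) ((r : ℂ) * f k) = (r : ℂ) * (starRingEnd ℂ) (f k)
    rw [map_mul, conj_ofReal]
  rw [bracket, h, map_smul, smul_eq_mul, bracket]

/-- The Fock representation twisted by the character of `T`, its vacuum state, and cyclicity of the
vacuum. -/
lemma exists_fockRep (T : Test d →ₗ[ℂ] ℂ) :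
    ∃ π : WeylAlgebra d →⋆ₐ[ℂ] (Fock d →L[ℂ] Fock d),
      (∀ f g, π (weyl f) (coherent g) = weylChar T f • weylPhase f g • coherent (f + g)) ∧
      (∀ f, vectorFunctional π (vacuum d) (weyl f) =
        exp (-(Real.pi ^ 2 / 2) * testInner f f) * weylChar T f) ∧
      DenseRange fun a => π a (vacuum d) := by
  obtain ⟨π, hπ⟩ := isCoherentFamily_coherent.exists_rep T
  refine ⟨π, hπ, vectorFunctional_vacuum_weyl hπ, ?_⟩
  have hcyc := isCoherentFamily_coherent.dense_range_rep hπ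
  rwa [coherent_zero] at hcyc

/-- The state is the vacuum state of the Fock representation twisted by the character of `-v/ϖ`; it
is regular because its values at `W(r f)` are Gaussian in `r` up to a phase linear in `r`. -/
theorem existsUnique_coherentState (ϖ : Dispersion d) (v : Dist d) :
    ∃! ρ : WeylAlgebra d →ₚ[ℂ] ℂ, IsCoherentState ϖ v ρ := by
  obtain ⟨π, -, hπ, -⟩ := exists_fockRep (-ϖ.divSource v)
  let ρ : WeylAlgebra d →ₚ[ℂ] ℂ := PositiveLinearMap.mk₀ (vectorFunctional π (vacuum d))
    fun _ ha => vectorFunctional_nonneg π (vacuum d) ha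
  have hρ : ∀ f, ρ (weyl f) = exp (-(Real.pi ^ 2 / 2) * testInner f f) *
    exp (2 * Real.pi * I * ((bracket f (-ϖ.divSource v)).re : ℂ)) := hπ
  refine ⟨ρ, ⟨?_, continuous_vectorFunctional π (vacuum d), fun f => ?_, hρ⟩, fun ρ' hρ' => ?_⟩
  · have h := hρ 0
    have h0 := weylChar_zero (-ϖ.divSource v)
    unfold weylChar at h0
    rw [isWeylSystem_weyl.map_zero, testInner_zero_left, h0, mul_zero, Complex.exp_zero,
      mul_one] at h
    exact h
  · simp_rw [hρ, testInner_ofReal_smul, bracket_ofReal_smul, re_ofReal_mul]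
    fun_prop
  · refine PositiveLinearMap.ext fun a => ?_
    exact eq_of_eq_on_weyl ρ'.toLinearMap (vectorFunctional π (vacuum d)) hρ'.continuous
      (continuous_vectorFunctional π (vacuum d))
      (fun f => (hρ'.map_weyl f).trans (hρ f).symm) a

/-- The coherent state is the vacuum state of any Fock representation with the same vacuum
expectation values of the Weyl operators. -/
lemma IsCoherentState.eq_vectorFunctional {ϖ : Dispersion d} {v : Dist d}
    {ρ : WeylAlgebra d →ₚ[ℂ] ℂ} (hρ : IsCoherentState ϖ v ρ)
    (π : WeylAlgebra d →⋆ₐ[ℂ] (Fock d →L[ℂ] Fock d))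
    (hπ : ∀ f, vectorFunctional π (vacuum d) (weyl f) =
      exp (-(Real.pi ^ 2 / 2) * testInner f f) * weylChar (-ϖ.divSource v) f) (a : WeylAlgebra d) :
    ρ a = vectorFunctional π (vacuum d) a :=
  eq_of_eq_on_weyl ρ.toLinearMap (vectorFunctional π (vacuum d))
    hρ.continuous (continuous_vectorFunctional π (vacuum d))
    (fun f => (hρ.map_weyl f).trans (hπ f).symm) a

lemma IsVanHoveDynamics.eq_conj_fockUnitary {ϖ : Dispersion d} {v : Dist d}
    {τ : ℝ → WeylAlgebra d ≃⋆ₐ[ℂ] WeylAlgebra d} (hτ : IsVanHoveDynamics ϖ v τ)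
    (π : WeylAlgebra d →⋆ₐ[ℂ] (Fock d →L[ℂ] Fock d))
    (hπ : ∀ f g, π (weyl f) (coherent g) =
      weylChar (-ϖ.divSource v) f • weylPhase f g • coherent (f + g))
    (t : ℝ) (a : WeylAlgebra d) (ψ : Fock d) :
    π (τ t a) ψ = ϖ.fockUnitary t (π a (ϖ.fockUnitary (-t) ψ)) :=
  isCoherentFamily_coherent.rep_dynamics hτ hπ ϖ.fockUnitary_coherent t a ψ

lemma exists_gns_fock (ρ : WeylAlgebra d →ₚ[ℂ] ℂ)
    (π : WeylAlgebra d →⋆ₐ[ℂ] (Fock d →L[ℂ] Fock d))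
    (hρπ : ∀ a, ρ a = vectorFunctional π (vacuum d) a)
    (hcyc : DenseRange fun a => π a (vacuum d)) :
    ∃ U : ρ.GNS ≃ₗᵢ[ℂ] Fock d,
      (∀ a ξ, U (ρ.gnsStarAlgHom a ξ) = π a (U ξ)) ∧ U (gnsVector ρ) = vacuum d :=
  exists_gns_unitary π (vacuum d) ρ hρπ hcyc

end VanHove

end

theorem mainTheorem7 (d : ℕ) (ϖ : VanHove.Dispersion d) (v : VanHove.Dist d) :
    (∃! τ : ℝ → VanHove.WeylAlgebra d ≃⋆ₐ[ℂ] VanHove.WeylAlgebra d,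
      VanHove.IsVanHoveDynamics ϖ v τ) ∧
    (∃! ρ : VanHove.WeylAlgebra d →ₚ[ℂ] ℂ, VanHove.IsCoherentState ϖ v ρ) ∧
    ∀ (τ : ℝ → VanHove.WeylAlgebra d ≃⋆ₐ[ℂ] VanHove.WeylAlgebra d)
      (ρ : VanHove.WeylAlgebra d →ₚ[ℂ] ℂ),
      VanHove.IsVanHoveDynamics ϖ v τ → VanHove.IsCoherentState ϖ v ρ →
      ∃ (π : VanHove.WeylAlgebra d →⋆ₐ[ℂ] (VanHove.Fock d →L[ℂ] VanHove.Fock d))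
        (U : ρ.GNS ≃ₗᵢ[ℂ] VanHove.Fock d)
        (V : ℝ → VanHove.Fock d ≃ₗᵢ[ℂ] VanHove.Fock d),
        (∀ a ξ, U (ρ.gnsStarAlgHom a ξ) = π a (U ξ)) ∧
        U (VanHove.gnsVector ρ) = VanHove.vacuum d ∧
        (∀ a, ρ a = inner ℂ (VanHove.vacuum d) (π a (VanHove.vacuum d))) ∧
        Dense (Set.range fun a => π a (VanHove.vacuum d)) ∧
        VanHove.IsUnitaryGroupOf (VanHove.secondQuant ϖ) V ∧
        ∀ (t : ℝ) (a : VanHove.WeylAlgebra d) (ψ : VanHove.Fock d),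
          π (τ t a) ψ = V t (π a (V (-t) ψ)) := by
  refine ⟨VanHove.existsUnique_dynamics ϖ v, VanHove.existsUnique_coherentState ϖ v,
    fun τ ρ hτ hρ => ?_⟩
  refine (VanHove.exists_fockRep (-ϖ.divSource v)).elim fun π hπ => ?_
  have hρπ := hρ.eq_vectorFunctional π hπ.2.1
  refine (VanHove.exists_gns_fock ρ π hρπ hπ.2.2).elim fun U hU => ?_
  exact ⟨π, U, ϖ.fockUnitary, hU.1, hU.2, hρπ, hπ.2.2, ϖ.isUnitaryGroupOf_fockUnitary,
    hτ.eq_conj_fockUnitary π hπ.1⟩
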